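/- Let $0<\alpha<1$. For a linear operator $A:D(A)\subset X\to X$ on a complex Banach space $X$ write $R(z;A)=(z-A)^{-1}$, and put $\Sigma_{\theta}=\{z\in\mathbb C\setminus\{0\}:|\arg z|<\theta\}$. $A$ is called sectorial of angle $\theta$ if it is closed and densely defined, its spectrum is contained in $\mathbb C\setminus\Sigma_\theta$, and $\{zR(z;A):z\in\Sigma_\theta\}$ is bounded in $\mathcal B(X)$. For $\tau>0$ and a sequence $(u^n)_{n\ge0}$ in $X$ let $$\bar\partial_\tau^\alpha u^n=\tau^{-\alpha}\sum_{j=0}^n b_{n-j}u^j,\qquad \sum_{j=0}^\infty b_j\xi^j=(1-\xi)^\alpha .$$ The backward Euler (BE) scheme with initial value $v\in X$ is: $u^0=v$ and, for all $n\ge1$, $u^n\in D(A)$ and $\bar\partial_\tau^\alpha(u-v)^n=Au^n$. For $x^1,\dots,x^N\in X$ let $$\|(x^n)_{n=1}^N\|_{L^p(X)}=\Big(\tau\sum_{n=1}^N\|x^n\|^p\Big)^{1/p}\ (p<\infty),\qquad \|(x^n)_{n=1}^N\|_{L^\infty(X)}=\max_{1\le n\le N}\|x^n\|,$$ $$\|(x^n)_{n=1}^N\|_{L^{p,\infty}(X)}=\sup_{\lambda>0}\lambda\,|\{1\le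 n\le N:\|x^n\|>\lambda\}|^{1/p}\,\tau^{1/p}.$$ Give $D(A)$ the graph norm $\|b\|_{D(A)}=\|b\|+\|Ab\|$ and let $(X,D(A))_{\theta,p}$ be the real interpolation space given by the K-method: with $K(t,v)=\inf_{b\in D(A)}\big(\|v-b\|+t\|b\|_{D(A)}\big)$, $$\|v\|_{(X,D(A))_{\theta,p}}=\Big(\int_0^\infty (t^{-\theta}K(t,v))^p\,\frac{dt}{t}\Big)^{1/p}\ (p<\infty),\qquad \|v\|_{(X,D(A))_{\theta,\infty}}=\sup_{t>0}t^{-\theta}K(t,v).$$ **Theorem.** For every $M$ and every $p\in[1,\infty]$ there is a constant $c_p$, depending only on $\alpha$, $p$ and $M$, such that the following holds for every complex Banach space $X$, every operator $A$ on $X$ that is sectorial of angle $\alpha\pi/2$ with $\|zR(z;A)\|\le M$ for all $z\in\Sigma_{\alpha\pi/2}$, every $\tau>0$, every $N$, every $v\in X$, and every solution $(u^n)$ of the BE scheme with initial value $v$. 1. If $p\in(1/\alpha,\infty]$, then $$\|(\bar\partial_\tau^\alpha (u-v)^n)_{n=1}^N\|_{L^p(X)}+\|(Au^n)_{n=1}^N\|_{L^p(X)}\le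 c_p\|v\|_{(X,D(A))_{1-\frac1{p\alpha},p}}$$ (nothing is claimed if the right-hand side is infinite). 2. If $p=1/\alpha$, then $$\|(\bar\partial_\tau^\alpha (u-v)^n)_{n=1}^N\|_{L^{p,\infty}(X)}+\|(\bar\partial_\tau^\alpha u^n)_{n=1}^N\|_{L^{p,\infty}(X)}+\|(Au^n)_{n=1}^N\|_{L^{p,\infty}(X)}\le c_p\|v\|_X .$$ 3. If $p\in[1,1/\alpha)$, then $$\|(\bar\partial_\tau^\alpha (u-v)^n)_{n=1}^N\|_{L^{p}(X)}+\|(\bar\partial_\tau^\alpha u^n)_{n=1}^N\|_{L^{p}(X)}+\|(Au^n)_{n=1}^N\|_{L^{p}(X)}\le c_p\,(N\tau)^{\frac1p-\alpha}\,\|v\|_X .$$ In particular, on a bounded time interval $N\tau\le T$ the constant $c_pT^{\frac1p-\alpha}$ is independent of $N$, $\tau$ and $A$. -/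

import Mathlib

open scoped NNReal ENNReal

noncomputable section

namespace FracBE

/-! ### Closed operators, resolvents and sectoriality -/

section Operators

variable {X : Type*} [NormedAddCommGroup X] [NormedSpace ℂ X]

/-- The open sector `Σ_θ = {z ≠ 0 : |arg z| < θ}`, with `arg z ∈ (-π, π]`. -/
def sector (θ : ℝ) : Set ℂ := {z | z ≠ 0 ∧ |z.arg| < θ}

/-- The bounded operator `R` is the resolvent `R(z;A) = (z - A)⁻¹` of the (unbounded) operator `A`,
i.e. a two-sided inverse of `z - A : D(A) → X`. Such an `R` is unique when it exists. -/
def IsResolvent (A : X →ₗ.[ℂ] X) (z : ℂ) (R : X →L[ℂ] X) : Prop :=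
  (∀ x : X, ∃ h : R x ∈ A.domain, z • R x - A ⟨R x, h⟩ = x) ∧
    ∀ y : A.domain, R (z • (y : X) - A y) = y

/-- The spectrum `σ(A)`: the set of all `z` for which `z - A` has no bounded inverse. -/
def opSpectrum (A : X →ₗ.[ℂ] X) : Set ℂ := {z | ¬ ∃ R : X →L[ℂ] X, IsResolvent A z R}

/-- `M` is a bound of the set of operators `{z R(z;A) : z ∈ Σ_θ}` in `B(X)`. -/
def SectorialBound (A : X →ₗ.[ℂ] X) (θ M : ℝ) : Prop :=
  ∀ z ∈ sector θ, ∀ R : X →L[ℂ] X, IsResolvent A z R → ‖z • R‖ ≤ M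

/-- `A` is sectorial of angle `θ`. -/
structure IsSectorial (A : X →ₗ.[ℂ] X) (θ : ℝ) : Prop where
  isClosed : A.IsClosed
  dense_domain : Dense (A.domain : Set X)
  spectrum_subset : opSpectrum A ⊆ (sector θ)ᶜ
  bounded : ∃ M : ℝ, SectorialBound A θ M

/-! ### The real interpolation space `(X, D(A))_{θ,p}` -/

/-- The K-functional of the couple `(X, D(A))`, where `D(A)` has the graph norm
`‖b‖ + ‖A b‖`: the infimum of `‖a‖ + t ‖b‖_{D(A)}` over all `v = a + b` with `b ∈ D(A)`. -/
def kFunctional (A : X →ₗ.[ℂ] X) (t : ℝ) (v : X) : ℝ≥0∞ :=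
  ⨅ b : A.domain, ‖v - (b : X)‖ₑ + ENNReal.ofReal t * (‖(b : X)‖ₑ + ‖A b‖ₑ)

/-- The norm of `v` in the real interpolation space `(X, D(A))_{θ,p}` (K-method). The space itself
consists of the `v` for which this is finite. For `p < ∞` it is
`(∫₀^∞ (t^{-θ} K(t,v))^p dt/t)^{1/p}`, for `p = ∞` it is `sup_{t>0} t^{-θ} K(t,v)`. -/
def interpNorm (A : X →ₗ.[ℂ] X) (θ : ℝ) (p : ℝ≥0∞) (v : X) : ℝ≥0∞ :=
  if p = ∞ then ⨆ (t : ℝ) (_ : 0 < t), ENNReal.ofReal (t ^ (-θ)) * kFunctional A t v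
  else (∫⁻ t in Set.Ioi (0 : ℝ),
    (ENNReal.ofReal (t ^ (-θ)) * kFunctional A t v) ^ p.toReal * ENNReal.ofReal t⁻¹)
      ^ p.toReal⁻¹

end Operators

/-! ### Scaled norms of finite sequences `(x^1, …, x^N)`, indexed by `Fin N` -/

section Norms

variable {X : Type*} [NormedAddCommGroup X]

/-- The scaled norm `(τ ∑_{n=1}^N ‖x^n‖^p)^{1/p}`, and `max_{1≤n≤N} ‖x^n‖` for `p = ∞`. -/
def scaledLp (τ : ℝ) (p : ℝ≥0∞) {N : ℕ} (x : Fin N → X) : ℝ≥0∞ :=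
  if p = ∞ then ⨆ n, ‖x n‖ₑ
  else (ENNReal.ofReal τ * ∑ n, ‖x n‖ₑ ^ p.toReal) ^ p.toReal⁻¹

/-- The scaled weak norm `sup_{l>0} l |{n : ‖x^n‖ > l}|^{1/p} τ^{1/p}`. -/
def scaledWeakLp (τ p : ℝ) {N : ℕ} (x : Fin N → X) : ℝ≥0∞ :=
  ⨆ (l : ℝ≥0) (_ : 0 < l),
    (l : ℝ≥0∞) * (Set.ncard {n : Fin N | (l : ℝ) < ‖x n‖} : ℝ≥0∞) ^ p⁻¹ * ENNReal.ofReal τ ^ p⁻¹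

end Norms

/-! ### The backward Euler convolution quadrature -/

/-- The weights `b_j` of the backward Euler convolution quadrature, `b_j = (-1)^j (α choose j)`. -/
def beCoeff (α : ℝ) (j : ℕ) : ℝ := (-1) ^ j * Ring.choose α j

/-- The weights are the power series coefficients of `δ(ξ)^α = (1 - ξ)^α`. -/
theorem hasSum_beCoeff (α : ℝ) {ξ : ℂ} (hξ : ‖ξ‖ < 1) :
    HasSum (fun j : ℕ => (beCoeff α j : ℂ) * ξ ^ j) ((1 - ξ) ^ (α : ℂ)) := by
  have h := (Complex.one_add_cpow_hasFPowerSeriesOnBall_zero (a := (α : ℂ))).hasSum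
    (y := -ξ) (by
      rw [Metric.mem_eball, edist_zero_right, enorm_neg, ← ofReal_norm, ENNReal.ofReal_lt_one]
      exact hξ)
  rw [zero_add, ← sub_eq_add_neg] at h
  have key : ∀ j : ℕ, binomialSeries ℂ (α : ℂ) j (fun _ => -ξ) = (beCoeff α j : ℂ) * ξ ^ j := by
    intro j
    simp only [binomialSeries_apply, List.ofFn_const, List.prod_replicate, beCoeff, smul_eq_mul]
    push_cast
    rw [neg_pow ξ j]
    ring
  simpa only [key] using h

section Scheme

variable {X : Type*} [NormedAddCommGroup X] [NormedSpace ℂ X]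

/-- `τ^{-α} ∑_{j=0}^n b_{n-j} u^j`, the backward Euler approximation of the fractional
derivative of order `α` at `t_n = n τ`. -/
def beDeriv (α τ : ℝ) (u : ℕ → X) (n : ℕ) : X :=
  ((τ ^ (-α) : ℝ) : ℂ) • ∑ j ∈ Finset.range (n + 1), (beCoeff α (n - j) : ℂ) • u j

/-- The sequence `(u^n)` solves the backward Euler scheme with initial value `v` (`0 < α < 1`):
`u^0 = v`, and, for all `n ≥ 1`, `u^n ∈ D(A)` and
`τ^{-α} ∑_{j=0}^n b_{n-j} (u^j - v) = A u^n`. -/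
structure IsBESolution (A : X →ₗ.[ℂ] X) (α τ : ℝ) (v : X) (u : ℕ → X) : Prop where
  init : u 0 = v
  mem : ∀ n : ℕ, u (n + 1) ∈ A.domain
  eq : ∀ n : ℕ, beDeriv α τ (fun j => u j - v) (n + 1) = A ⟨u (n + 1), mem n⟩

end Scheme

end FracBE

end

namespace FracBE

/-! Everything follows from one pointwise bound, `norm_beDeriv_sub_le`: with t_n = nτ, ‖Au^n‖ ≤ C
(t_n^(-α) ‖v - b‖ + ‖Ab‖) for every b in D(A).

Put z = ((1 - ξ)/τ)^α and T = z R(z;A). The disc maps into the sector, so T is bounded, and T' = -α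
(T - T²)/(1 - ξ) costs one factor 1/|1 - ξ|. Modulo ξ^(n+2), the generating polynomial of Au^1, …,
Au^(n+1) is ξ (1 - ξ)⁻¹ z (T - 1) v. Since (T - 1) b = R(z;A) Ab, writing v = (v - b) + b splits it
into weights (1 - ξ)^(α-1) on v - b and (1 - ξ)^(-1) on Ab (`exists_sum_eq_resolvent`). Cauchy's
formula for the derivative on a circle at distance about 1/n from the unit circle turns these
weights into n^(-α) and n^0 (`norm_coeff_le`). Working modulo a power of ξ removes any question of
convergence for the series of u.

The infimum over b gives ‖Au^n‖ ≤ C K(t,v)/t at t = t_n^α. As K(t,v)/t decreases, its L^p sum is at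
most the interpolation integral (`sum_kFunctional_le`). Taking b = 0 gives decay t_n^(-α), which is
weak L^(1/α), and L^p for p < 1/α. Dropping the shift by v costs τ^(-α) times a partial sum of the
b_j, of the same decay. -/

/-! ### Size of 1 - ξ on circles -/

open Real in
-- The square of the norm is (1 - r)² + 2r(1 - cos θ), and 1 - cos θ is at least a multiple of θ² on
-- [0, π].
theorem le_norm_one_sub_circleMap {r θ : ℝ} (hr : 1 / 2 ≤ r) (hr1 : r ≤ 1) (h0 : 0 ≤ θ)
    (hπ : θ ≤ π) : (1 - r + θ) / 4 ≤ ‖1 - circleMap 0 r θ‖ := by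
  have h1 : ‖1 - circleMap 0 r θ‖ ^ 2 = 1 - 2 * r * Real.cos θ + r ^ 2 := by
    rw [← Complex.normSq_eq_norm_sq, Complex.normSq_apply]
    simp only [circleMap_zero, Complex.sub_re, Complex.sub_im, Complex.one_re, Complex.one_im,
      Complex.re_ofReal_mul, Complex.im_ofReal_mul, Complex.exp_ofReal_mul_I_re,
      Complex.exp_ofReal_mul_I_im]
    nlinarith [Real.sin_sq_add_cos_sq θ]
  have h2 : Real.cos θ ≤ 1 - 2 / π ^ 2 * θ ^ 2 :=
    Real.cos_le_one_sub_mul_cos_sq (by rwa [abs_of_nonneg h0])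
  have hpi : 1 / 5 ≤ 2 / π ^ 2 := by
    rw [div_le_div_iff₀ (by norm_num) (by positivity)]
    nlinarith [Real.pi_lt_d2, Real.pi_pos]
  have h3 : Real.cos θ ≤ 1 - 1 / 5 * θ ^ 2 := by nlinarith [sq_nonneg θ]
  refine abs_le_of_sq_le_sq' ?_ (norm_nonneg _) |>.2
  rw [h1]
  nlinarith [sq_nonneg (1 - r - θ), mul_nonneg (by linarith : (0:ℝ) ≤ r - 1/2) (sq_nonneg θ)]

theorem norm_one_sub_circleMap_two_pi_sub (r θ : ℝ) :
    ‖1 - circleMap 0 r (2 * Real.pi - θ)‖ = ‖1 - circleMap 0 r θ‖ := by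
  rw [← Complex.norm_conj (1 - circleMap 0 r θ)]
  congr 1
  apply Complex.ext <;>
    simp [circleMap_zero, Complex.exp_ofReal_mul_I_re, Complex.exp_ofReal_mul_I_im,
      Real.cos_two_pi_sub, Real.sin_two_pi_sub, - Complex.ofReal_sub, - Complex.ofReal_mul]

theorem one_sub_circleMap_ne_zero {r : ℝ} (hr0 : 0 ≤ r) (hr1 : r < 1) (θ : ℝ) :
    1 - circleMap 0 r θ ≠ 0 := by
  intro h
  have h1 : ‖circleMap 0 r θ‖ = 1 := by rw [← sub_eq_zero.mp h, norm_one]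
  rw [norm_circleMap_zero, abs_of_nonneg hr0] at h1
  exact hr1.ne h1

theorem continuous_norm_one_sub_circleMap_rpow {r : ℝ} (hr0 : 0 ≤ r) (hr1 : r < 1) (s : ℝ) :
    Continuous fun θ => ‖1 - circleMap 0 r θ‖ ^ s :=
  ((continuous_const.sub (continuous_circleMap 0 r)).norm).rpow_const fun θ =>
    Or.inl (norm_ne_zero_iff.mpr (one_sub_circleMap_ne_zero hr0 hr1 θ))

theorem integral_add_rpow_neg_le {δ b s : ℝ} (hδ : 0 < δ) (hb : 0 ≤ b) (hs : 1 < s) :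
    ∫ θ in 0..b, (δ + θ) ^ (-s) ≤ δ ^ (1 - s) / (s - 1) := by
  rw [intervalIntegral.integral_comp_add_left (fun x => x ^ (-s)) δ, integral_rpow]
  · rw [add_zero, show -s + 1 = -(s - 1) by ring, show 1 - s = -(s - 1) by ring, div_neg,
      ← neg_div]
    have : 0 ≤ (δ + b) ^ (-(s - 1)) := by positivity
    gcongr
    linarith
  · right
    refine ⟨by linarith, ?_⟩
    rw [add_zero, Set.uIcc_of_le (by linarith)]
    exact fun h => absurd h.1 (by linarith)

open Real in
-- Reflection reduces to the upper half circle, where the linear lower bound leaves the integral of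
-- (1 - r + θ)^(-s).
theorem integral_norm_one_sub_circleMap_rpow_le {r s : ℝ} (hr : 1 / 2 ≤ r) (hr1 : r < 1)
    (hs : 1 < s) :
    ∫ θ in 0..2 * π, ‖1 - circleMap 0 r θ‖ ^ (-s) ≤ 2 * 4 ^ s / (s - 1) * (1 - r) ^ (1 - s) := by
  have hc := continuous_norm_one_sub_circleMap_rpow (by linarith) hr1 (-s)
  have hsplit : ∫ θ in 0..2 * π, ‖1 - circleMap 0 r θ‖ ^ (-s)
      = 2 * ∫ θ in 0..π, ‖1 - circleMap 0 r θ‖ ^ (-s) := by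
    have := intervalIntegral.integral_comp_sub_left
      (fun θ => ‖1 - circleMap 0 r θ‖ ^ (-s)) (2 * π) (a := 0) (b := π)
    simp only [norm_one_sub_circleMap_two_pi_sub] at this
    rw [sub_zero, show 2 * π - π = π by ring] at this
    rw [← intervalIntegral.integral_add_adjacent_intervals (hc.intervalIntegrable 0 π)
      (hc.intervalIntegrable π (2 * π)), ← this]
    ring
  have hle : ∫ θ in 0..π, ‖1 - circleMap 0 r θ‖ ^ (-s)
      ≤ ∫ θ in 0..π, 4 ^ s * ((1 - r) + θ) ^ (-s) := by
    refine intervalIntegral.integral_mono_on pi_pos.le (hc.intervalIntegrable _ _) ?_ ?_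
    · refine ContinuousOn.intervalIntegrable ?_
      rw [Set.uIcc_of_le pi_pos.le]
      refine ContinuousOn.mul continuousOn_const (ContinuousOn.rpow_const (by fun_prop) ?_)
      intro x hx
      left
      linarith [hx.1]
    · intro θ hθ
      have h1 := le_norm_one_sub_circleMap hr hr1.le hθ.1 hθ.2
      have h2 : 0 < (1 - r + θ) / 4 := by linarith [hθ.1]
      calc ‖1 - circleMap 0 r θ‖ ^ (-s) ≤ ((1 - r + θ) / 4) ^ (-s) :=
            Real.rpow_le_rpow_of_nonpos h2 h1 (by linarith)
        _ = 4 ^ s * (1 - r + θ) ^ (-s) := by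
            rw [Real.div_rpow (by linarith) (by norm_num), Real.rpow_neg (by norm_num : (0:ℝ) ≤ 4),
              div_inv_eq_mul, mul_comm]
  rw [intervalIntegral.integral_const_mul] at hle
  have h3 := integral_add_rpow_neg_le (b := π) (by linarith : 0 < 1 - r) pi_pos.le hs
  have h4 : (0:ℝ) < 4 ^ s := by positivity
  calc _ ≤ 2 * (4 ^ s * ((1 - r) ^ (1 - s) / (s - 1))) := by
        rw [hsplit]; gcongr; exact hle.trans (by gcongr)
    _ = _ := by ring

/-! ### Taylor coefficients from the growth of the derivative -/

section Coefficients
variable {E : Type*} [NormedAddCommGroup E] [NormedSpace ℂ E]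

theorem circleIntegral_inv_pow_smul_sum (n : ℕ) (a : ℕ → E) {r : ℝ} (hr : 0 < r) [CompleteSpace E] :
    (∮ ξ in C(0, r), (ξ ^ (n + 1))⁻¹ • ∑ m ∈ Finset.range (n + 1), ξ ^ m • a m)
      = (2 * Real.pi * Complex.I) • a n := by
  have h1 : (∮ ξ in C(0, r), (ξ ^ (n + 1))⁻¹ • ∑ m ∈ Finset.range (n + 1), ξ ^ m • a m)
      = ∮ ξ in C(0, r), ∑ m ∈ Finset.range (n + 1), (ξ - 0) ^ ((m : ℤ) - (n + 1)) • a m := by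
    refine circleIntegral.integral_congr hr.le fun ξ hξ => ?_
    have hξ0 : ξ ≠ 0 := by
      rintro rfl
      simp at hξ
      exact hr.ne hξ
    simp only [Finset.smul_sum, sub_zero, smul_smul]
    refine Finset.sum_congr rfl fun m _ => ?_
    rw [zpow_sub₀ hξ0, zpow_natCast, div_eq_mul_inv, mul_comm]
    norm_cast
  have hint : ∀ k : ℤ, ∀ b : E, CircleIntegrable (fun ξ : ℂ => (ξ - 0) ^ k • b) 0 r := by
    intro k b
    refine ContinuousOn.circleIntegrable hr.le (ContinuousOn.smul ?_ continuousOn_const)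
    refine ContinuousOn.zpow₀ (by fun_prop) _ fun ξ hξ => Or.inl ?_
    rintro h
    rw [sub_zero] at h
    subst h
    simp at hξ
    exact hr.ne hξ
  rw [h1, circleIntegral.integral_fun_sum fun i _ => hint _ _, Finset.sum_range_succ,
    Finset.sum_eq_zero, zero_add]
  · rw [circleIntegral.integral_smul_const, show (n : ℤ) - (n + 1) = -1 by ring]
    simp only [zpow_neg_one]
    rw [circleIntegral.integral_sub_center_inv _ hr.ne']
  · intro m hm
    rw [circleIntegral.integral_smul_const, circleIntegral.integral_sub_zpow_of_ne, zero_smul]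
    have := Finset.mem_range.mp hm
    omega

variable [CompleteSpace E]

/-- The derivative of ξ^(n+2) h is still divisible by ξ^(n+1), so the remainder contributes an
analytic integrand and drops out. -/
theorem integral_deriv_eq_of_sum_eq_add {n : ℕ} {a : ℕ → E} {G h : ℂ → E}
    (hG : DifferentiableOn ℂ G (Metric.ball 0 1)) (hh : DifferentiableOn ℂ h (Metric.ball 0 1))
    (heq : ∀ ξ ∈ Metric.ball (0 : ℂ) 1,
      ∑ m ∈ Finset.range (n + 1), ξ ^ (m + 1) • a m = G ξ + ξ ^ (n + 2) • h ξ)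
    {r : ℝ} (hr : 0 < r) (hr1 : r < 1) :
    (∮ ξ in C(0, r), (ξ ^ (n + 1))⁻¹ • deriv G ξ)
      = (2 * Real.pi * Complex.I) • ((n + 1 : ℂ) • a n) := by
  have hopen : IsOpen (Metric.ball (0 : ℂ) 1) := Metric.isOpen_ball
  have hsub : Metric.closedBall (0 : ℂ) r ⊆ Metric.ball 0 1 := Metric.closedBall_subset_ball hr1
  have hsub' : Metric.sphere (0 : ℂ) r ⊆ Metric.ball 0 1 :=
    Metric.sphere_subset_closedBall.trans hsub
  have hder : ∀ ξ ∈ Metric.ball (0 : ℂ) 1,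
      deriv G ξ = ∑ m ∈ Finset.range (n + 1), ξ ^ m • ((m + 1 : ℂ) • a m)
        - ξ ^ (n + 1) • ((n + 2 : ℂ) • h ξ + ξ • deriv h ξ) := by
    intro ξ hξ
    have hnhds := hopen.mem_nhds hξ
    have h1 : HasDerivAt (fun ξ : ℂ => ∑ m ∈ Finset.range (n + 1), ξ ^ (m + 1) • a m)
        (∑ m ∈ Finset.range (n + 1), ξ ^ m • ((m + 1 : ℂ) • a m)) ξ := by
      refine HasDerivAt.fun_sum fun m _ => ?_
      have := (hasDerivAt_pow (m + 1) ξ).smul_const (a m)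
      convert this using 1
      rw [smul_smul, mul_comm]
      simp
    have h2 := (hasDerivAt_pow (n + 2) ξ).smul ((hh.differentiableAt hnhds).hasDerivAt)
    have h3 := h1.sub h2
    have h4 : G =ᶠ[nhds ξ] (fun ξ : ℂ => ∑ m ∈ Finset.range (n + 1), ξ ^ (m + 1) • a m)
        - fun ξ => ξ ^ (n + 2) • h ξ := by
      filter_upwards [hnhds] with x hx
      simp [heq x hx]
    rw [h4.deriv_eq]
    refine h3.deriv.trans ?_
    congr 1
    rw [smul_add, smul_smul, smul_smul, add_comm]
    congr 2
    rw [show n + 2 - 1 = n + 1 from rfl]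
    push_cast
    ring
  have hdG : ContinuousOn (deriv G) (Metric.sphere 0 r) :=
    (hG.deriv hopen).continuousOn.mono hsub'
  set q : ℂ → E := fun ξ => (n + 2 : ℂ) • h ξ + ξ • deriv h ξ
  have hq : DifferentiableOn ℂ q (Metric.ball 0 1) :=
    (hh.const_smul _).add (differentiableOn_id.smul (hh.deriv hopen))
  have hq0 : (∮ ξ in C(0, r), q ξ) = 0 :=
    (hq.mono hsub).diffContOnCl_ball subset_rfl |>.circleIntegral_eq_zero hr.le
  have hne : ∀ ξ ∈ Metric.sphere (0 : ℂ) r, ξ ≠ 0 := by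
    rintro ξ hξ rfl
    simp at hξ
    exact hr.ne hξ
  have hcont : ContinuousOn (fun ξ : ℂ => (ξ ^ (n + 1))⁻¹ • deriv G ξ) (Metric.sphere 0 r) :=
    ContinuousOn.smul (ContinuousOn.inv₀ (by fun_prop) fun ξ hξ => pow_ne_zero _ (hne ξ hξ)) hdG
  rw [← circleIntegral_inv_pow_smul_sum n (fun m => (m + 1 : ℂ) • a m) hr,
    ← add_zero (∮ ξ in C(0, r), (ξ ^ (n + 1))⁻¹ • deriv G ξ), ← hq0,
    ← circleIntegral.integral_add (hcont.circleIntegrable hr.le)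
      ((hq.continuousOn.mono hsub').circleIntegrable hr.le)]
  refine circleIntegral.integral_congr hr.le fun ξ hξ => ?_
  have hξ0 := pow_ne_zero (n + 1) (hne ξ hξ)
  simp only [hder ξ (hsub' hξ), smul_sub, smul_smul, inv_mul_cancel₀ hξ0, one_smul, q]
  rw [sub_add_cancel]

/-- The constant in the bound of the Taylor coefficients by the size of the derivative. -/
noncomputable def coeffConst (s : ℝ) : ℝ := 8 ^ s / (s - 1)

/-- Differentiating first makes both exponents exceed 1, so the circle integral is of order N^(s-1);
the factor N = n + 1 in front of the coefficient then yields N^(s-2). Applied to G itself, with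
exponents 1 - α and 1, the same estimate would give no decay and a logarithm. -/
theorem norm_coeff_le {n : ℕ} {a : ℕ → E} {G h : ℂ → E}
    (hG : DifferentiableOn ℂ G (Metric.ball 0 1)) (hh : DifferentiableOn ℂ h (Metric.ball 0 1))
    (heq : ∀ ξ ∈ Metric.ball (0 : ℂ) 1,
      ∑ m ∈ Finset.range (n + 1), ξ ^ (m + 1) • a m = G ξ + ξ ^ (n + 2) • h ξ)
    {s₁ s₂ C₁ C₂ : ℝ} (hs₁ : 1 < s₁) (hs₂ : 1 < s₂) (hC₁ : 0 ≤ C₁) (hC₂ : 0 ≤ C₂)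
    (hbd : ∀ ξ ∈ Metric.ball (0 : ℂ) 1,
      ‖deriv G ξ‖ ≤ C₁ * ‖1 - ξ‖ ^ (-s₁) + C₂ * ‖1 - ξ‖ ^ (-s₂)) :
    ‖a n‖ ≤ C₁ * coeffConst s₁ * (n + 1 : ℝ) ^ (s₁ - 2)
      + C₂ * coeffConst s₂ * (n + 1 : ℝ) ^ (s₂ - 2) := by
  set N : ℝ := n + 1 with hN
  have hN1 : 1 ≤ N := by simp [hN]
  -- Here 1 - r = 1/(N + 1), while r^(-N) = (1 + 1/N)^N stays below e.
  set r : ℝ := N / (N + 1) with hrdef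
  have hr : 1 / 2 ≤ r := by
    rw [hrdef, div_le_div_iff₀ (by norm_num) (by linarith)]; linarith
  have hr1 : r < 1 := by rw [hrdef, div_lt_one (by linarith)]; linarith
  have hr0 : 0 < r := by linarith
  have h1r : 1 - r = (N + 1)⁻¹ := by rw [hrdef]; field_simp; ring
  have hrinv : (r ^ (n + 1))⁻¹ ≤ Real.exp 1 := by
    have h1 : r⁻¹ ≤ Real.exp (1 / N) := by
      have := Real.add_one_le_exp (1 / N)
      refine le_trans (le_of_eq ?_) this
      rw [hrdef]; field_simp; ring
    calc (r ^ (n + 1))⁻¹ = (r⁻¹) ^ (n + 1) := by rw [inv_pow]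
      _ ≤ (Real.exp (1 / N)) ^ (n + 1) := by gcongr
      _ = Real.exp 1 := by
        rw [← Real.exp_nat_mul]
        congr 1
        push_cast
        rw [← hN]; field_simp
  have hI := integral_deriv_eq_of_sum_eq_add hG hh heq hr0 hr1
  have hc := fun s => continuous_norm_one_sub_circleMap_rpow hr0.le hr1 s
  have hnorm : ‖∮ ξ in C(0, r), (ξ ^ (n + 1))⁻¹ • deriv G ξ‖
      ≤ ∫ θ in 0..2 * Real.pi, Real.exp 1 * (C₁ * ‖1 - circleMap 0 r θ‖ ^ (-s₁)
          + C₂ * ‖1 - circleMap 0 r θ‖ ^ (-s₂)) := by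
    refine intervalIntegral.norm_integral_le_of_norm_le (by positivity) ?_ ?_
    · refine Filter.Eventually.of_forall fun θ _ => ?_
      have hmem : circleMap 0 r θ ∈ Metric.ball (0 : ℂ) 1 := by
        simp [abs_of_pos hr0, hr1]
      rw [norm_smul, norm_smul, deriv_circleMap, norm_mul, Complex.norm_I, mul_one, norm_inv,
        norm_pow, norm_circleMap_zero, abs_of_pos hr0]
      calc r * ((r ^ (n + 1))⁻¹ * ‖deriv G (circleMap 0 r θ)‖)
          ≤ 1 * (Real.exp 1 * _) := by
            gcongr
            exact hbd _ hmem
        _ = _ := one_mul _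
    · exact (continuous_const.mul ((continuous_const.mul (hc _)).add
        (continuous_const.mul (hc _)))).intervalIntegrable _ _
  rw [hI, intervalIntegral.integral_const_mul, intervalIntegral.integral_add
    (((hc _).intervalIntegrable _ _).const_mul _)
    (((hc _).intervalIntegrable _ _).const_mul _), intervalIntegral.integral_const_mul,
    intervalIntegral.integral_const_mul] at hnorm
  have key : ∀ s : ℝ, 1 < s → ∫ θ in 0..2 * Real.pi, ‖1 - circleMap 0 r θ‖ ^ (-s)
      ≤ 2 * coeffConst s * N ^ (s - 1) := by
    intro s hs
    refine (integral_norm_one_sub_circleMap_rpow_le hr hr1 hs).trans ?_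
    rw [h1r, Real.inv_rpow (by linarith), ← Real.rpow_neg (by linarith), neg_sub, coeffConst]
    have h2 : (N + 1) ^ (s - 1) ≤ 2 ^ s * N ^ (s - 1) := by
      calc (N + 1) ^ (s - 1) ≤ (2 * N) ^ (s - 1) := by
            apply Real.rpow_le_rpow <;> linarith
        _ = 2 ^ (s - 1) * N ^ (s - 1) := Real.mul_rpow (by norm_num) (by linarith)
        _ ≤ 2 ^ s * N ^ (s - 1) := by
            gcongr
            · norm_num
            · linarith
    have h8 : (8 : ℝ) ^ s = 4 ^ s * 2 ^ s := by
      rw [← Real.mul_rpow (by norm_num) (by norm_num)]; norm_num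
    have hs1 : 0 < s - 1 := by linarith
    calc 2 * 4 ^ s / (s - 1) * (N + 1) ^ (s - 1)
        ≤ 2 * 4 ^ s / (s - 1) * (2 ^ s * N ^ (s - 1)) := by gcongr
      _ = 2 * (8 ^ s / (s - 1)) * N ^ (s - 1) := by rw [h8]; ring
  have hL : ‖(2 * Real.pi * Complex.I) • ((n + 1 : ℂ) • a n)‖ = 2 * Real.pi * (N * ‖a n‖) := by
    rw [norm_smul, norm_smul]
    have : ‖(n + 1 : ℂ)‖ = N := by
      rw [show (n + 1 : ℂ) = ((n + 1 : ℕ) : ℂ) by push_cast; rfl, Complex.norm_natCast]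
      push_cast; rfl
    rw [this]
    simp [abs_of_pos Real.pi_pos]
  rw [hL] at hnorm
  have hfin : 2 * Real.pi * (N * ‖a n‖) ≤ 2 * Real.pi * (N * (C₁ * coeffConst s₁ * N ^ (s₁ - 2)
      + C₂ * coeffConst s₂ * N ^ (s₂ - 2))) := by
    have hpow : ∀ s : ℝ, N ^ (s - 1) = N * N ^ (s - 2) := by
      intro s
      rw [show s - 1 = 1 + (s - 2) by ring, Real.rpow_add (by linarith), Real.rpow_one]
    -- Replacing e by π lets the prefactor 2π of Cauchy's formula cancel exactly.
    have he : Real.exp 1 ≤ Real.pi := by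
      linarith [Real.exp_one_lt_d9, Real.pi_gt_three]
    have hcc : ∀ s : ℝ, 1 < s → 0 ≤ coeffConst s := fun s hs =>
      div_nonneg (by positivity) (by linarith)
    have h0 : ∀ s : ℝ, 0 ≤ ∫ θ in 0..2 * Real.pi, ‖1 - circleMap 0 r θ‖ ^ (-s) := fun s =>
      intervalIntegral.integral_nonneg (by positivity) fun _ _ => by positivity
    have h01 := h0 s₁
    have h02 := h0 s₂
    have hc1 := hcc s₁ hs₁
    have hc2 := hcc s₂ hs₂
    calc _ ≤ _ := hnorm
      _ ≤ Real.pi * (C₁ * (2 * coeffConst s₁ * N ^ (s₁ - 1))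
          + C₂ * (2 * coeffConst s₂ * N ^ (s₂ - 1))) := by
          gcongr
          · exact key s₁ hs₁
          · exact key s₂ hs₂
      _ = _ := by rw [hpow, hpow]; ring
  exact le_of_mul_le_mul_left (le_of_mul_le_mul_left hfin (by positivity)) (by linarith)

end Coefficients

/-! ### Functions with a weight (1 - ξ)^(β-1) -/

section Weighted
variable {E : Type*} [NormedAddCommGroup E] [NormedSpace ℂ E]

theorem one_sub_mem_slitPlane {ξ : ℂ} (hξ : ‖ξ‖ < 1) : 1 - ξ ∈ Complex.slitPlane := by
  left
  rw [Complex.sub_re, Complex.one_re]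
  linarith [(le_abs_self _).trans (Complex.abs_re_le_norm ξ)]

theorem hasDerivAt_one_sub_cpow {ξ : ℂ} (hξ : ‖ξ‖ < 1) (c : ℂ) :
    HasDerivAt (fun ξ : ℂ => (1 - ξ) ^ c) (-c * (1 - ξ) ^ (c - 1)) ξ := by
  have := ((hasDerivAt_id ξ).const_sub 1).cpow_const (c := c) (one_sub_mem_slitPlane hξ)
  refine this.congr_deriv ?_
  rw [id]
  ring

theorem hasDerivAt_weighted {T : ℂ → E} {ξ : ℂ} (hξ : ‖ξ‖ < 1) (hT : DifferentiableAt ℂ T ξ)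
    (β : ℝ) :
    HasDerivAt (fun ξ => ξ • (1 - ξ) ^ ((β - 1 : ℝ) : ℂ) • T ξ)
      (ξ • ((1 - ξ) ^ ((β - 1 : ℝ) : ℂ) • deriv T ξ
          + (-((β - 1 : ℝ) : ℂ) * (1 - ξ) ^ (((β - 1 : ℝ) : ℂ) - 1)) • T ξ)
        + (1 : ℂ) • (1 - ξ) ^ ((β - 1 : ℝ) : ℂ) • T ξ) ξ :=
  (hasDerivAt_id ξ).smul ((hasDerivAt_one_sub_cpow hξ _).smul hT.hasDerivAt)

/-- Differentiating T or the weight costs one factor 1/|1 - ξ|. Differentiating ξ costs none, and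
that term is absorbed by |1 - ξ| ≤ 2; hence 4 = 1 + 1 + 2. -/
theorem norm_deriv_weighted_le {T : ℂ → E} {ξ : ℂ} (hξ : ‖ξ‖ < 1) (hT : DifferentiableAt ℂ T ξ)
    {β B : ℝ} (hβ₀ : 0 ≤ β) (hβ₁ : β ≤ 1) (hB : ‖T ξ‖ ≤ B) (hB' : ‖deriv T ξ‖ ≤ B / ‖1 - ξ‖) :
    ‖deriv (fun ξ => ξ • (1 - ξ) ^ ((β - 1 : ℝ) : ℂ) • T ξ) ξ‖
      ≤ 4 * B * ‖1 - ξ‖ ^ (-(2 - β)) := by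
  rw [(hasDerivAt_weighted hξ hT β).deriv]
  have h0 : 0 < ‖1 - ξ‖ := norm_pos_iff.mpr (Complex.slitPlane_ne_zero (one_sub_mem_slitPlane hξ))
  have h2 : ‖1 - ξ‖ ≤ 2 := (norm_sub_le _ _).trans (by rw [norm_one]; linarith)
  have hB0 : 0 ≤ B := (norm_nonneg _).trans hB
  set q := ‖1 - ξ‖ ^ (-(2 - β)) with hq
  have hq0 : 0 ≤ q := by positivity
  have e1 : ‖(1 - ξ) ^ ((β - 1 : ℝ) : ℂ)‖ = q * ‖1 - ξ‖ := by
    rw [Complex.norm_cpow_real, hq, ← Real.rpow_add_one h0.ne']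
    congr 1; ring
  have e2 : ‖(1 - ξ) ^ (((β - 1 : ℝ) : ℂ) - 1)‖ = q := by
    rw [show (((β - 1 : ℝ) : ℂ) - 1) = ((-(2 - β) : ℝ) : ℂ) by push_cast; ring,
      Complex.norm_cpow_real]
  have e3 : ‖(-((β - 1 : ℝ) : ℂ))‖ ≤ 1 := by
    rw [norm_neg, Complex.norm_real, Real.norm_eq_abs, abs_le]
    constructor <;> linarith
  have t1 : ‖(1 - ξ) ^ ((β - 1 : ℝ) : ℂ) • deriv T ξ‖ ≤ q * B := by
    rw [norm_smul, e1]
    calc q * ‖1 - ξ‖ * ‖deriv T ξ‖ ≤ q * ‖1 - ξ‖ * (B / ‖1 - ξ‖) := by gcongr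
      _ = q * B := by field_simp
  have t2 : ‖(-((β - 1 : ℝ) : ℂ) * (1 - ξ) ^ (((β - 1 : ℝ) : ℂ) - 1)) • T ξ‖ ≤ q * B := by
    rw [norm_smul, norm_mul, e2]
    calc _ ≤ 1 * q * B := by gcongr
      _ = q * B := by ring
  have t3 : ‖(1 : ℂ) • (1 - ξ) ^ ((β - 1 : ℝ) : ℂ) • T ξ‖ ≤ q * 2 * B := by
    rw [one_smul, norm_smul, e1]
    gcongr
  have t4 : ‖ξ • ((1 - ξ) ^ ((β - 1 : ℝ) : ℂ) • deriv T ξ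
          + (-((β - 1 : ℝ) : ℂ) * (1 - ξ) ^ (((β - 1 : ℝ) : ℂ) - 1)) • T ξ)‖ ≤ q * B + q * B := by
    rw [norm_smul]
    calc _ ≤ 1 * (q * B + q * B) := by
          gcongr
          exact (norm_add_le _ _).trans (add_le_add t1 t2)
      _ = _ := one_mul _
  refine (norm_add_le _ _).trans ((add_le_add t4 t3).trans (le_of_eq ?_))
  ring

end Weighted

/-- A convergent power series splits into a Taylor polynomial and an analytic remainder. -/
theorem exists_differentiableOn_remainder {c : ℕ → ℂ} {φ : ℂ → ℂ}
    (hφ : ∀ ξ ∈ Metric.ball (0 : ℂ) 1, HasSum (fun i => c i * ξ ^ i) (φ ξ)) (k : ℕ) :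
    ∃ g : ℂ → ℂ, DifferentiableOn ℂ g (Metric.ball 0 1) ∧ ∀ ξ ∈ Metric.ball (0 : ℂ) 1,
      φ ξ = ∑ i ∈ Finset.range k, c i * ξ ^ i + ξ ^ k * g ξ := by
  refine ⟨fun ξ => ∑' i, c (i + k) * ξ ^ i, ?_, ?_⟩
  · intro ξ hξ
    rw [mem_ball_zero_iff] at hξ
    obtain ⟨ρ, hρ, hρ1⟩ := exists_between hξ
    have hρ0 : 0 < ρ := (norm_nonneg _).trans_lt hρ
    have hs : Summable fun i => ‖c (i + k)‖ * ρ ^ i := by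
      have h1 := (hφ (ρ : ℂ) (by simpa [abs_of_pos hρ0] using hρ1)).summable.norm
      have h2 := ((summable_nat_add_iff k).mpr h1).mul_right ((ρ ^ k)⁻¹)
      refine h2.congr fun i => ?_
      rw [norm_mul, norm_pow, Complex.norm_real, Real.norm_eq_abs, abs_of_pos hρ0, pow_add]
      field_simp
    refine (DifferentiableOn.differentiableAt (s := Metric.ball 0 ρ)
      (Complex.differentiableOn_tsum_of_summable_norm hs (fun i => by fun_prop)
      Metric.isOpen_ball fun i w hw => ?_) ?_).differentiableWithinAt
    · rw [mem_ball_zero_iff] at hw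
      rw [norm_mul, norm_pow]
      gcongr
    · exact Metric.isOpen_ball.mem_nhds (by simpa using hρ)
  · intro ξ hξ
    have h := hφ ξ hξ
    rw [← h.tsum_eq, ← h.summable.sum_add_tsum_nat_add k, ← tsum_mul_left]
    congr 2
    ext i
    ring

/-! ### The resolvent along the symbol -/

section Resolvent
variable {X : Type*} [NormedAddCommGroup X] [NormedSpace ℂ X] {A : X →ₗ.[ℂ] X}

theorem isOpen_sector {θ : ℝ} (hθ : θ ≤ Real.pi) : IsOpen (sector θ) := by
  rw [isOpen_iff_mem_nhds]
  rintro z ⟨hz, harg⟩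
  have hs : z ∈ Complex.slitPlane := by
    rw [Complex.mem_slitPlane_iff_arg]
    refine ⟨fun h => ?_, hz⟩
    rw [h, abs_of_pos Real.pi_pos] at harg
    linarith
  filter_upwards [isOpen_ne.mem_nhds hz,
    (Complex.continuousAt_arg hs).abs.eventually_lt_const harg] with w hw hw'
  exact ⟨hw, hw'⟩

theorem IsResolvent.sub_eq {z w : ℂ} {R Q : X →L[ℂ] X} (hR : IsResolvent A z R)
    (hQ : IsResolvent A w Q) : Q - R = (z - w) • (Q * R) := by
  ext x
  obtain ⟨h, hx⟩ := hR.1 x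
  have h1 := hQ.2 ⟨R x, h⟩
  have h2 : Q x = Q (w • R x - A ⟨R x, h⟩) + (z - w) • Q (R x) := by
    rw [← Q.map_smul (z - w), ← Q.map_add]
    congr 1
    nth_rewrite 1 [← hx]
    module
  simp only [sub_apply, smul_apply, mul_apply_eq_comp]
  rw [h2]
  simp only at h1
  rw [h1, add_sub_cancel_left]

/-- The bound on z R(z) makes R bounded near z; the resolvent identity then gives continuity, and a
second use of it gives the limit of the slopes. -/
theorem hasDerivAt_resolvent {Ω : Set ℂ} (hΩ : IsOpen Ω) {R : ℂ → X →L[ℂ] X} {M : ℝ}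
    (hR : ∀ z ∈ Ω, IsResolvent A z (R z)) (hM : ∀ z ∈ Ω, ‖z • R z‖ ≤ M) {z : ℂ} (hz : z ∈ Ω)
    (hz0 : z ≠ 0) : HasDerivAt R (-(R z * R z)) z := by
  have hΩz := hΩ.mem_nhds hz
  have hzn : 0 < ‖z‖ := norm_pos_iff.mpr hz0
  have hcont : ContinuousAt R z := by
    rw [ContinuousAt, tendsto_iff_norm_sub_tendsto_zero]
    have hlim : Filter.Tendsto (fun w => ‖z - w‖ * (M / (‖z‖ / 2) * ‖R z‖)) (nhds z) (nhds 0) := by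
      have : ContinuousAt (fun w => ‖z - w‖ * (M / (‖z‖ / 2) * ‖R z‖)) z := by fun_prop
      simpa [ContinuousAt] using this
    refine squeeze_zero' (Filter.Eventually.of_forall fun _ => norm_nonneg _) ?_ hlim
    filter_upwards [hΩz, (continuous_norm.continuousAt (x := z)).eventually_const_lt
      (half_lt_self hzn)] with w hw hwn
    rw [(hR z hz).sub_eq (hR w hw), norm_smul]
    gcongr
    refine (norm_mul_le _ _).trans ?_
    gcongr
    rw [le_div_iff₀ (by positivity)]
    calc ‖R w‖ * (‖z‖ / 2) ≤ ‖R w‖ * ‖w‖ := by gcongr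
      _ ≤ M := by rw [mul_comm, ← norm_smul]; exact hM w hw
  rw [hasDerivAt_iff_tendsto_slope]
  have hlim : Filter.Tendsto (fun w => -(R w * R z)) (nhdsWithin z {z}ᶜ) (nhds (-(R z * R z))) :=
    ((hcont.tendsto.mul_const _).neg).mono_left nhdsWithin_le_nhds
  refine hlim.congr' ?_
  filter_upwards [nhdsWithin_le_nhds hΩz, self_mem_nhdsWithin] with w hw hwz
  rw [slope_def_module, (hR z hz).sub_eq (hR w hw), smul_smul, ← neg_sub w z, mul_neg,
    inv_mul_cancel₀ (sub_ne_zero.mpr hwz), neg_one_smul]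

/-- The symbol `((1 - ξ) / τ) ^ α` of the backward Euler convolution quadrature. -/
noncomputable def beSymbol (α τ : ℝ) (ξ : ℂ) : ℂ := ((τ ^ (-α) : ℝ) : ℂ) * (1 - ξ) ^ (α : ℂ)

/-- 1 - ξ lies in the right half plane, and the power α multiplies its argument by α. This is why
the angle απ/2 suffices. -/
theorem beSymbol_mem_sector {α τ : ℝ} (hα₀ : 0 < α) (hα₁ : α < 1) (hτ : 0 < τ) {ξ : ℂ}
    (hξ : ‖ξ‖ < 1) : beSymbol α τ ξ ∈ sector (α * Real.pi / 2) := by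
  have hs := one_sub_mem_slitPlane hξ
  have h0 := Complex.slitPlane_ne_zero hs
  have hτα : 0 < τ ^ (-α) := by positivity
  have harg : |(1 - ξ).arg| < Real.pi / 2 := by
    rw [Complex.abs_arg_lt_pi_div_two_iff]
    left
    rw [Complex.sub_re, Complex.one_re]
    linarith [(le_abs_self _).trans (Complex.abs_re_le_norm ξ)]
  refine ⟨mul_ne_zero (Complex.ofReal_ne_zero.mpr hτα.ne') (by simp [Complex.cpow_eq_zero_iff, h0]), ?_⟩
  rw [beSymbol, Complex.arg_real_mul _ hτα, Complex.cpow_def_of_ne_zero h0, ← Complex.log_im,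
    Complex.log_exp, Complex.im_mul_ofReal, Complex.log_im,
    abs_mul, abs_of_pos hα₀]
  · nlinarith
  · rw [Complex.im_mul_ofReal, Complex.log_im]
    have := (abs_lt.mp harg).1
    nlinarith [Real.pi_pos]
  · rw [Complex.im_mul_ofReal, Complex.log_im]
    have := (abs_lt.mp harg).2
    nlinarith [Real.pi_pos]

theorem hasDerivAt_beSymbol {α τ : ℝ} {ξ : ℂ} (hξ : ‖ξ‖ < 1) :
    HasDerivAt (beSymbol α τ) (-(α / (1 - ξ)) * beSymbol α τ ξ) ξ := by
  have h0 := Complex.slitPlane_ne_zero (one_sub_mem_slitPlane hξ)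
  have h := (hasDerivAt_one_sub_cpow hξ α).const_mul ((τ ^ (-α) : ℝ) : ℂ)
  refine h.congr_deriv ?_
  rw [beSymbol, Complex.cpow_sub _ _ h0, Complex.cpow_one]
  field_simp

/-- From (zR)' = R - zR² and dz/dξ = -αz/(1 - ξ): the factor z recombines into zR - (zR)², so the
bound is uniform in τ. -/
theorem hasDerivAt_beSymbol_smul_resolvent {α τ M : ℝ} (hα₀ : 0 < α) (hα₁ : α < 1) (hτ : 0 < τ)
    {R : ℂ → X →L[ℂ] X} (hR : ∀ z ∈ sector (α * Real.pi / 2), IsResolvent A z (R z))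
    (hM : ∀ z ∈ sector (α * Real.pi / 2), ‖z • R z‖ ≤ M) {ξ : ℂ} (hξ : ‖ξ‖ < 1) :
    HasDerivAt (fun ξ => beSymbol α τ ξ • R (beSymbol α τ ξ))
      (-(α / (1 - ξ)) • (beSymbol α τ ξ • R (beSymbol α τ ξ) -
        (beSymbol α τ ξ • R (beSymbol α τ ξ)) * (beSymbol α τ ξ • R (beSymbol α τ ξ)))) ξ := by
  have hmem := beSymbol_mem_sector hα₀ hα₁ hτ hξ
  have hopen : IsOpen (sector (α * Real.pi / 2)) := isOpen_sector (by nlinarith [Real.pi_pos])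
  have h1 := hasDerivAt_resolvent hopen hR hM hmem hmem.1
  have h2 := hasDerivAt_beSymbol (α := α) (τ := τ) hξ
  refine (h2.smul (h1.scomp ξ h2)).congr_deriv ?_
  simp only [Function.comp_apply, smul_neg, smul_sub, smul_smul, smul_mul_smul_comm]
  module

end Resolvent

/-! ### Generating polynomial of the scheme and the pointwise bound -/

section Scheme
variable {X : Type*} [NormedAddCommGroup X] [NormedSpace ℂ X] {A : X →ₗ.[ℂ] X}

/-- Discrete convolution is multiplication by the symbol modulo ξ^K, with no growth condition on w.
-/
theorem exists_beSymbol_smul_sum_eq (α τ : ℝ) (w : ℕ → X) (K : ℕ) :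
    ∃ h : ℂ → X, DifferentiableOn ℂ h (Metric.ball 0 1) ∧ ∀ ξ ∈ Metric.ball (0 : ℂ) 1,
      beSymbol α τ ξ • ∑ j ∈ Finset.range K, ξ ^ j • w j
        = ∑ m ∈ Finset.range K, ξ ^ m • beDeriv α τ w m + ξ ^ K • h ξ := by
  have hsum : ∀ ξ ∈ Metric.ball (0 : ℂ) 1,
      HasSum (fun i => (((τ ^ (-α) : ℝ) : ℂ) * (beCoeff α i : ℂ)) * ξ ^ i) (beSymbol α τ ξ) := by
    intro ξ hξ
    simpa only [mul_assoc, beSymbol] using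
      (hasSum_beCoeff α (mem_ball_zero_iff.mp hξ)).mul_left ((τ ^ (-α) : ℝ) : ℂ)
  choose g hg hgeq using exists_differentiableOn_remainder hsum
  refine ⟨fun ξ => ∑ j ∈ Finset.range K, g (K - j) ξ • w j,
    DifferentiableOn.fun_sum fun j _ => (hg _).smul_const _, fun ξ hξ => ?_⟩
  -- The symbol is truncated at degree K - j, so that multiplication by ξ^j puts every remainder at
  -- ξ^K.
  have hterm : ∀ j ∈ Finset.range K, beSymbol α τ ξ • ξ ^ j • w j
      = ∑ m ∈ Finset.Ico j K,
          ξ ^ m • (((τ ^ (-α) : ℝ) : ℂ) * (beCoeff α (m - j) : ℂ)) • w j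
        + ξ ^ K • g (K - j) ξ • w j := by
    intro j hj
    rw [hgeq (K - j) ξ hξ, add_smul, Finset.sum_smul, Finset.sum_Ico_eq_sum_range]
    congr 1
    · refine Finset.sum_congr rfl fun i _ => ?_
      rw [smul_smul, smul_smul, Nat.add_sub_cancel_left, pow_add]
      congr 1
      ring
    · rw [smul_smul, smul_smul, ← Nat.sub_add_cancel (Finset.mem_range.mp hj).le, pow_add,
        Nat.sub_add_cancel (Finset.mem_range.mp hj).le]
      congr 1
      ring
  rw [Finset.smul_sum, Finset.sum_congr rfl hterm, Finset.sum_add_distrib, Finset.smul_sum]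
  congr 1
  rw [Finset.range_eq_Ico, Finset.sum_Ico_Ico_comm]
  refine Finset.sum_congr rfl fun m _ => ?_
  rw [beDeriv, Finset.range_eq_Ico, ← Finset.smul_sum]
  simp only [mul_smul, ← Finset.smul_sum]

/-- The generating polynomial of `A u^1, …, A u^{n+1}` in terms of the resolvent. -/
theorem exists_sum_eq_resolvent {α τ : ℝ} (hα₀ : 0 < α) (hα₁ : α < 1) (hτ : 0 < τ)
    {R : ℂ → X →L[ℂ] X} (hR : ∀ z ∈ sector (α * Real.pi / 2), IsResolvent A z (R z))
    {v : X} {u : ℕ → X} (hu : IsBESolution A α τ v u) (b : A.domain) (n : ℕ)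
    (hT : DifferentiableOn ℂ (fun ξ => beSymbol α τ ξ • R (beSymbol α τ ξ)) (Metric.ball 0 1)) :
    ∃ h : ℂ → X, DifferentiableOn ℂ h (Metric.ball 0 1) ∧ ∀ ξ ∈ Metric.ball (0 : ℂ) 1,
      ∑ m ∈ Finset.range (n + 1), ξ ^ (m + 1) • beDeriv α τ (fun j => u j - v) (m + 1)
        = (ξ • (1 - ξ) ^ ((α - 1 : ℝ) : ℂ) • ((τ ^ (-α) : ℝ) : ℂ) •
              ((beSymbol α τ ξ • R (beSymbol α τ ξ)) (v - b) - (v - b))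
            + ξ • (1 - ξ) ^ ((0 - 1 : ℝ) : ℂ) • (beSymbol α τ ξ • R (beSymbol α τ ξ)) (A b))
          + ξ ^ (n + 2) • h ξ := by
  obtain ⟨h₁, hh₁, heq₁⟩ := exists_beSymbol_smul_sum_eq α τ (fun j => u j - v) (n + 2)
  have hZ : DifferentiableOn ℂ (beSymbol α τ) (Metric.ball 0 1) := fun ξ hξ =>
    (hasDerivAt_beSymbol (mem_ball_zero_iff.mp hξ)).differentiableAt.differentiableWithinAt
  have hne : ∀ ξ ∈ Metric.ball (0 : ℂ) 1, 1 - ξ ≠ 0 := fun ξ hξ =>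
    Complex.slitPlane_ne_zero (one_sub_mem_slitPlane (mem_ball_zero_iff.mp hξ))
  -- Two truncation errors of order ξ^(n+2): that of the convolution, and that of the geometric sum
  -- multiplying v.
  set h₂ : ℂ → X := fun ξ => h₁ ξ - (beSymbol α τ ξ / (1 - ξ)) • v with hh₂
  have hh₂' : DifferentiableOn ℂ h₂ (Metric.ball 0 1) :=
    hh₁.sub ((hZ.div (by fun_prop) hne).smul_const v)
  refine ⟨fun ξ => (beSymbol α τ ξ • R (beSymbol α τ ξ)) (h₂ ξ) - h₂ ξ,
    (hT.clm_apply hh₂').sub hh₂', fun ξ hξ => ?_⟩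
  have hξ0 := hne ξ hξ
  have hres := hR _ (beSymbol_mem_sector hα₀ hα₁ hτ (mem_ball_zero_iff.mp hξ))
  have hz : ((τ ^ (-α) : ℝ) : ℂ) * (1 - ξ) ^ ((α - 1 : ℝ) : ℂ) = beSymbol α τ ξ / (1 - ξ) := by
    rw [beSymbol, Complex.ofReal_sub, Complex.ofReal_one, Complex.cpow_sub _ _ hξ0,
      Complex.cpow_one, mul_div_assoc]
  have hz' : (1 - ξ) ^ ((0 - 1 : ℝ) : ℂ) = (1 - ξ)⁻¹ := by
    rw [zero_sub, Complex.ofReal_neg, Complex.ofReal_one, Complex.cpow_neg_one]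
  rw [hz', smul_comm ((1 - ξ) ^ ((α - 1 : ℝ) : ℂ)), smul_smul (((τ ^ (-α) : ℝ) : ℂ)), hz]
  specialize heq₁ ξ hξ
  simp only [hh₂]
  generalize beSymbol α τ ξ = z at *
  set P := ∑ m ∈ Finset.range (n + 1), ξ ^ (m + 1) • beDeriv α τ (fun j => u j - v) (m + 1)
    with hP
  set y : A.domain := ∑ m ∈ Finset.range (n + 1), ξ ^ (m + 1) • ⟨u (m + 1), hu.mem m⟩ with hy
  have hAy : A y = P := by
    rw [hy, hP]
    change A.toFun _ = _
    rw [map_sum]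
    refine Finset.sum_congr rfl fun m _ => ?_
    rw [map_smul, hu.eq m]
    rfl
  set s : ℂ := ∑ m ∈ Finset.range (n + 1), ξ ^ (m + 1) with hs
  have hs' : s = ξ / (1 - ξ) - ξ ^ (n + 2) / (1 - ξ) := by
    have h1 : s = ξ * ∑ m ∈ Finset.range (n + 1), ξ ^ m := by
      rw [hs, Finset.mul_sum]
      exact Finset.sum_congr rfl fun m _ => pow_succ' ξ m
    have h2 := mul_neg_geom_sum ξ (n + 1)
    rw [h1, ← sub_div, eq_div_iff hξ0]
    calc ξ * (∑ m ∈ Finset.range (n + 1), ξ ^ m) * (1 - ξ)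
        = ξ * ((1 - ξ) * ∑ m ∈ Finset.range (n + 1), ξ ^ m) := by ring
      _ = _ := by rw [h2]; ring
  have hy' : (y : X) = ∑ m ∈ Finset.range (n + 2), ξ ^ m • (u m - v) + s • v := by
    rw [Finset.sum_range_succ', hu.init, sub_self, smul_zero, add_zero, hs, Finset.sum_smul,
      ← Finset.sum_add_distrib, hy]
    push_cast
    refine Finset.sum_congr rfl fun m _ => ?_
    rw [← smul_add, sub_add_cancel]
  have hd0 : beDeriv α τ (fun j => u j - v) 0 = 0 := by simp [beDeriv, hu.init]
  rw [Finset.sum_range_succ' (fun m => ξ ^ m • beDeriv α τ (fun j => u j - v) m), hd0, smul_zero, add_zero, ← hP] at heq₁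
  set F := ξ ^ (n + 2) • h₁ ξ + (z * s) • v with hF
  have hzy : z • (y : X) - A y = F := by
    rw [hAy, hy', smul_add, heq₁, hF, smul_smul]
    abel
  have hPF : P = (z • R z) F - F := by
    have h1 := hres.2 y
    rw [hzy] at h1
    rw [smul_apply, h1, ← hzy, hAy]
    abel
  -- Membership of b in D(A) trades a factor z for A acting on b, which lowers the singular weight
  -- on v - b to one without z on Ab.
  have hb : (z • R z) b - b = R z (A b) := by
    have h1 := hres.2 b
    rw [map_sub, map_smul, sub_eq_iff_eq_add] at h1
    rw [smul_apply, h1]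
    abel
  have hv : (z • R z) v - v = ((z • R z) (v - b) - (v - b)) + R z (A b) := by
    rw [← hb, map_sub]
    abel
  have hF' : F = (ξ * (z / (1 - ξ))) • v + ξ ^ (n + 2) • (h₁ ξ - (z / (1 - ξ)) • v) := by
    rw [hF, hs', smul_sub, smul_smul, mul_sub, sub_smul]
    rw [show z * (ξ / (1 - ξ)) = ξ * (z / (1 - ξ)) by ring,
      show z * (ξ ^ (n + 2) / (1 - ξ)) = ξ ^ (n + 2) * (z / (1 - ξ)) by ring]
    abel
  rw [hPF, hF', map_add, map_smul, map_smul, add_sub_add_comm, ← smul_sub, ← smul_sub, hv, mul_smul,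
    smul_add, smul_add]
  congr 3
  rw [smul_apply, smul_smul, div_eq_inv_mul]

/-- The constant in the pointwise bound of `A u^n`. -/
noncomputable def pointwiseConst (α M : ℝ) : ℝ :=
  4 * (M + 1) ^ 2 * (coeffConst (2 - α) + coeffConst 2)

/-- The weights β = α and β = 0 give derivative exponents 2 - α and 2, hence coefficients of order
n^(-α) and n^0; the factor τ^(-α) completes t_n^(-α). -/
theorem norm_beDeriv_sub_le [CompleteSpace X] {α τ M : ℝ} (hα₀ : 0 < α) (hα₁ : α < 1) (hτ : 0 < τ)
    (hA : IsSectorial A (α * Real.pi / 2)) (hM : SectorialBound A (α * Real.pi / 2) M)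
    {v : X} {u : ℕ → X} (hu : IsBESolution A α τ v u) (n : ℕ) (b : A.domain) :
    ‖beDeriv α τ (fun j => u j - v) (n + 1)‖
      ≤ pointwiseConst α M * (((n + 1) * τ) ^ (-α) * ‖v - b‖ + ‖A b‖) := by
  have hex : ∀ z, ∃ R : X →L[ℂ] X, z ∈ sector (α * Real.pi / 2) → IsResolvent A z R := by
    intro z
    by_cases hz : z ∈ sector (α * Real.pi / 2)
    · by_contra! h
      exact hA.spectrum_subset (show z ∈ opSpectrum A from fun ⟨R, hR⟩ => (h R).2 hR) hz
    · exact ⟨0, fun h => absurd h hz⟩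
  choose R hR using hex
  have hRM : ∀ z ∈ sector (α * Real.pi / 2), ‖z • R z‖ ≤ M := fun z hz => hM z hz _ (hR z hz)
  have hTd := fun {ξ : ℂ} (hξ : ‖ξ‖ < 1) =>
    hasDerivAt_beSymbol_smul_resolvent (τ := τ) hα₀ hα₁ hτ hR hRM hξ
  set T : ℂ → X →L[ℂ] X := fun ξ => beSymbol α τ ξ • R (beSymbol α τ ξ) with hTdef
  have hTM : ∀ {ξ : ℂ}, ‖ξ‖ < 1 → ‖T ξ‖ ≤ M := fun hξ =>
    hRM _ (beSymbol_mem_sector hα₀ hα₁ hτ hξ)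
  -- The point ξ = 0 shows that the sector is nonempty.
  have hM0 : 0 ≤ M := (norm_nonneg _).trans (hTM (ξ := 0) (by simp))
  have hTM' : ∀ {ξ : ℂ}, ‖ξ‖ < 1 → ‖deriv T ξ‖ ≤ (M + 1) ^ 2 / ‖1 - ξ‖ := by
    intro ξ hξ
    rw [(hTd hξ).deriv, norm_smul, norm_neg, norm_div, Complex.norm_real, Real.norm_eq_abs,
      abs_of_pos hα₀]
    have h1 : ‖T ξ - T ξ * T ξ‖ ≤ M + M * M :=
      (norm_sub_le _ _).trans (add_le_add (hTM hξ) ((norm_mul_le _ _).trans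
        (mul_le_mul (hTM hξ) (hTM hξ) (norm_nonneg _) hM0)))
    calc α / ‖1 - ξ‖ * ‖T ξ - T ξ * T ξ‖ ≤ 1 / ‖1 - ξ‖ * (M + 1) ^ 2 := by
          gcongr
          nlinarith
      _ = _ := by ring
  have hTdiff : DifferentiableOn ℂ T (Metric.ball 0 1) := fun ξ hξ =>
    (hTd (mem_ball_zero_iff.mp hξ)).differentiableAt.differentiableWithinAt
  obtain ⟨h, hh, heq⟩ := exists_sum_eq_resolvent hα₀ hα₁ hτ hR hu b n hTdiff
  set T₁ : ℂ → X := fun ξ => ((τ ^ (-α) : ℝ) : ℂ) • (T ξ (v - b) - (v - b)) with hT₁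
  set T₂ : ℂ → X := fun ξ => T ξ (A b) with hT₂
  have hTx : ∀ x : X, ∀ {ξ : ℂ}, ‖ξ‖ < 1 → HasDerivAt (fun ξ => T ξ x) (deriv T ξ x) ξ :=
    fun x ξ hξ => by
      simpa using (hTd hξ).differentiableAt.hasDerivAt.clm_apply (hasDerivAt_const ξ x)
  have hT₁' : ∀ {ξ : ℂ}, ‖ξ‖ < 1 →
      HasDerivAt T₁ (((τ ^ (-α) : ℝ) : ℂ) • deriv T ξ (v - b)) ξ := fun hξ =>
    ((hTx _ hξ).sub_const _).const_smul _
  have hτα : 0 < τ ^ (-α) := by positivity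
  have hnτ : ‖((τ ^ (-α) : ℝ) : ℂ)‖ = τ ^ (-α) := by
    rw [Complex.norm_real, Real.norm_eq_abs, abs_of_pos hτα]
  -- (M + 1)² dominates M, M + 1 and M + M², the bounds of T, T - 1 and T - T².
  set B₁ : ℝ := (M + 1) ^ 2 * (τ ^ (-α) * ‖v - b‖) with hB₁
  set B₂ : ℝ := (M + 1) ^ 2 * ‖A b‖ with hB₂
  have bd₁ : ∀ {ξ : ℂ}, ‖ξ‖ < 1 → ‖T₁ ξ‖ ≤ B₁ := by
    intro ξ hξ
    rw [hT₁, norm_smul, hnτ, hB₁]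
    have h1 : ‖T ξ (v - b) - (v - b)‖ ≤ (M + 1) ^ 2 * ‖v - b‖ := by
      calc _ ≤ M * ‖v - b‖ + ‖v - b‖ :=
            (norm_sub_le _ _).trans (add_le_add_left ((T ξ).le_of_opNorm_le (hTM hξ) _) _)
        _ ≤ _ := by nlinarith [norm_nonneg (v - b), mul_nonneg hM0 (norm_nonneg (v - b)),
              mul_nonneg (mul_nonneg hM0 hM0) (norm_nonneg (v - b))]
    calc _ ≤ τ ^ (-α) * ((M + 1) ^ 2 * ‖v - b‖) := by gcongr
      _ = _ := by ring
  have bd₁' : ∀ {ξ : ℂ}, ‖ξ‖ < 1 → ‖deriv T₁ ξ‖ ≤ B₁ / ‖1 - ξ‖ := by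
    intro ξ hξ
    rw [(hT₁' hξ).deriv, norm_smul, hnτ, hB₁]
    calc _ ≤ τ ^ (-α) * ((M + 1) ^ 2 / ‖1 - ξ‖ * ‖v - b‖) := by
          gcongr
          exact (deriv T ξ).le_of_opNorm_le (hTM' hξ) _
      _ = _ := by ring
  have bd₂ : ∀ {ξ : ℂ}, ‖ξ‖ < 1 → ‖T₂ ξ‖ ≤ B₂ := by
    intro ξ hξ
    refine ((T ξ).le_of_opNorm_le (hTM hξ) _).trans ?_
    rw [hB₂]
    gcongr
    nlinarith
  have bd₂' : ∀ {ξ : ℂ}, ‖ξ‖ < 1 → ‖deriv T₂ ξ‖ ≤ B₂ / ‖1 - ξ‖ := by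
    intro ξ hξ
    rw [(hTx (A b) hξ).deriv, hB₂]
    refine ((deriv T ξ).le_of_opNorm_le (hTM' hξ) _).trans (le_of_eq ?_)
    ring
  set G₁ : ℂ → X := fun ξ => ξ • (1 - ξ) ^ ((α - 1 : ℝ) : ℂ) • T₁ ξ with hG₁
  set G₂ : ℂ → X := fun ξ => ξ • (1 - ξ) ^ ((0 - 1 : ℝ) : ℂ) • T₂ ξ with hG₂
  have dG₁ : ∀ {ξ : ℂ}, ‖ξ‖ < 1 → DifferentiableAt ℂ G₁ ξ := fun hξ =>
    (hasDerivAt_weighted hξ (hT₁' hξ).differentiableAt α).differentiableAt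
  have dG₂ : ∀ {ξ : ℂ}, ‖ξ‖ < 1 → DifferentiableAt ℂ G₂ ξ := fun hξ =>
    (hasDerivAt_weighted hξ (hTx _ hξ).differentiableAt 0).differentiableAt
  have hfin := norm_coeff_le (n := n) (a := fun m => beDeriv α τ (fun j => u j - v) (m + 1))
    (G := G₁ + G₂) (h := h) (s₁ := 2 - α) (s₂ := 2) (C₁ := 4 * B₁) (C₂ := 4 * B₂)
    (fun ξ hξ => ((dG₁ (mem_ball_zero_iff.mp hξ)).add
      (dG₂ (mem_ball_zero_iff.mp hξ))).differentiableWithinAt) hh heq (by linarith) (by norm_num)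
    (by positivity) (by positivity) (fun ξ hξ => by
      have hξ := mem_ball_zero_iff.mp hξ
      rw [deriv_add (dG₁ hξ) (dG₂ hξ)]
      refine (norm_add_le _ _).trans (add_le_add ?_ ?_)
      · exact norm_deriv_weighted_le hξ (hT₁' hξ).differentiableAt hα₀.le hα₁.le (bd₁ hξ)
          (bd₁' hξ)
      · have := norm_deriv_weighted_le hξ (hTx _ hξ).differentiableAt le_rfl zero_le_one (bd₂ hξ)
          (bd₂' hξ)
        rwa [sub_zero] at this)
  refine hfin.trans ?_
  have hc1 : 0 ≤ coeffConst (2 - α) := div_nonneg (by positivity) (by linarith)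
  have hc2 : 0 ≤ coeffConst 2 := div_nonneg (by positivity) (by norm_num)
  rw [sub_self, Real.rpow_zero, show 2 - α - 2 = -α by ring, Real.mul_rpow (by positivity) hτ.le,
    pointwiseConst, hB₁, hB₂]
  have hx : 0 ≤ ((n : ℝ) + 1) ^ (-α) * τ ^ (-α) * ‖v - b‖ := by positivity
  have hy : 0 ≤ ‖A b‖ := norm_nonneg _
  have hM2 : 0 ≤ 4 * (M + 1) ^ 2 := by positivity
  calc _ = 4 * (M + 1) ^ 2 * (coeffConst (2 - α) * (((n : ℝ) + 1) ^ (-α) * τ ^ (-α) * ‖v - b‖)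
          + coeffConst 2 * ‖A b‖) := by ring
    _ ≤ 4 * (M + 1) ^ 2 * ((coeffConst (2 - α) + coeffConst 2)
          * (((n : ℝ) + 1) ^ (-α) * τ ^ (-α) * ‖v - b‖ + ‖A b‖)) := by
        gcongr
        nlinarith [mul_nonneg hc1 hy, mul_nonneg hc2 hx]
    _ = _ := by ring

end Scheme

/-! ### Partial sums of the quadrature weights -/

theorem beCoeff_succ (α : ℝ) (j : ℕ) :
    beCoeff α (j + 1) = -beCoeff (α - 1) j + beCoeff (α - 1) (j + 1) := by
  have h := Ring.choose_succ_succ (α - 1) j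
  rw [sub_add_cancel] at h
  rw [beCoeff, beCoeff, beCoeff, h, pow_succ]
  ring

/-- Pascal's rule telescopes, as (1 - ξ)^α / (1 - ξ) = (1 - ξ)^(α-1). -/
theorem sum_beCoeff (α : ℝ) (n : ℕ) :
    ∑ j ∈ Finset.range (n + 1), beCoeff α j = beCoeff (α - 1) n := by
  induction n with
  | zero => simp [beCoeff]
  | succ n ih => rw [Finset.sum_range_succ, ih, beCoeff_succ]; ring

theorem beCoeff_sub_one_succ (α : ℝ) (n : ℕ) :
    beCoeff (α - 1) (n + 1) = (1 - α / (n + 1)) * beCoeff (α - 1) n := by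
  have h := Ring.choose_eq_smul (a := α - 1) (n := n + 1)
  have h' := Ring.choose_eq_smul (a := α - 1) (n := n)
  rw [descPochhammer_succ_right] at h
  simp only [Polynomial.smeval_mul, Polynomial.smeval_sub, Polynomial.smeval_X,
    Polynomial.smeval_natCast] at h
  rw [beCoeff, beCoeff, h, h', Nat.factorial_succ]
  simp only [smul_eq_mul]
  have : ((n : ℝ) + 1) ≠ 0 := by positivity
  have h2 : (n.factorial : ℝ) ≠ 0 := by positivity
  push_cast
  field_simp
  simp
  ring

theorem abs_sum_beCoeff_le {α : ℝ} (hα₀ : 0 < α) (hα₁ : α < 1) (n : ℕ) :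
    |∑ j ∈ Finset.range (n + 1), beCoeff α j| ≤ (n + 1 : ℝ) ^ (-α) := by
  rw [sum_beCoeff]
  have key : 0 ≤ beCoeff (α - 1) n ∧ beCoeff (α - 1) n ≤ (n + 1 : ℝ) ^ (-α) := by
    induction n with
    | zero => simp [beCoeff]
    | succ n ih =>
      have hn : (0 : ℝ) < n + 1 := by positivity
      have hf : 0 ≤ 1 - α / (n + 1 : ℝ) := by
        rw [sub_nonneg, div_le_one hn]
        have : (0 : ℝ) ≤ n := by positivity
        linarith
      -- With x = 1/(n + 1): 1 - αx ≤ 1 - α log(1 + x) ≤ (1 + x)^(-α). The right-hand sides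
      -- telescope in the product.
      have hf' : 1 - α / (n + 1 : ℝ) ≤ ((n + 2) / (n + 1) : ℝ) ^ (-α) := by
        rw [Real.rpow_def_of_pos (by positivity)]
        have h1 := Real.log_le_sub_one_of_pos (x := ((n + 2) / (n + 1) : ℝ)) (by positivity)
        have h2 : ((n + 2) / (n + 1) : ℝ) - 1 = 1 / (n + 1) := by field_simp; ring
        rw [h2] at h1
        have h3 := Real.add_one_le_exp (Real.log ((n + 2) / (n + 1) : ℝ) * -α)
        have h4 : α * Real.log ((n + 2) / (n + 1) : ℝ) ≤ α * (1 / (n + 1)) := by gcongr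
        have h5 : α / (n + 1 : ℝ) = α * (1 / (n + 1)) := by ring
        linarith
      rw [beCoeff_sub_one_succ]
      refine ⟨mul_nonneg hf ih.1, ?_⟩
      calc _ ≤ ((n + 2) / (n + 1) : ℝ) ^ (-α) * (n + 1 : ℝ) ^ (-α) :=
            mul_le_mul hf' ih.2 ih.1 (by positivity)
        _ = _ := by
          rw [← Real.mul_rpow (by positivity) (by positivity), div_mul_cancel₀ _ hn.ne']
          push_cast
          congr 1
          ring
  rw [abs_of_nonneg key.1]
  exact key.2

theorem norm_beDeriv_le {X : Type*} [NormedAddCommGroup X] [NormedSpace ℂ X]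
    {α τ : ℝ} (hα₀ : 0 < α) (hα₁ : α < 1) (hτ : 0 < τ) (u : ℕ → X) (v : X) (n : ℕ) :
    ‖beDeriv α τ u (n + 1)‖
      ≤ ‖beDeriv α τ (fun j => u j - v) (n + 1)‖ + ((n + 1) * τ) ^ (-α) * ‖v‖ := by
  have h1 : beDeriv α τ u (n + 1) = beDeriv α τ (fun j => u j - v) (n + 1)
      + ((τ ^ (-α) : ℝ) : ℂ) • ((∑ j ∈ Finset.range (n + 1 + 1), beCoeff α j : ℝ) : ℂ) • v := by
    simp only [beDeriv]
    rw [← smul_add, ← Finset.sum_range_reflect (fun j => beCoeff α j), Complex.ofReal_sum,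
      Finset.sum_smul, ← Finset.sum_add_distrib]
    congr 1
    refine Finset.sum_congr rfl fun j _ => ?_
    rw [show n + 1 + 1 - 1 - j = n + 1 - j by omega, ← smul_add, sub_add_cancel]
  rw [h1]
  refine (norm_add_le _ _).trans (add_le_add_right ?_ _)
  rw [norm_smul, norm_smul, Complex.norm_real, Complex.norm_real, Real.norm_eq_abs,
    Real.norm_eq_abs, abs_of_pos (by positivity), Real.mul_rpow (by positivity) hτ.le, ← mul_assoc,
    mul_comm (((n : ℝ) + 1) ^ (-α))]
  gcongr
  -- The sum has n + 2 terms; its bound (n + 2)^(-α) is weakened to (n + 1)^(-α).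
  refine (abs_sum_beCoeff_le hα₀ hα₁ (n + 1)).trans ?_
  push_cast
  exact Real.rpow_le_rpow_of_nonpos (by positivity) (by linarith) (by linarith)


/-! ### Norms of sequences decaying like t^(-α) -/

section Norms
variable {X : Type*} [NormedAddCommGroup X]

/-- A norm above l forces the time to be at most (B/l)^(1/α), so at most (B/l)^(1/α)/τ indices
qualify. -/
theorem scaledWeakLp_le {α τ B : ℝ} (hα₀ : 0 < α) (hτ : 0 < τ) (hB : 0 ≤ B) {N : ℕ}
    {x : Fin N → X} (hx : ∀ n : Fin N, ‖x n‖ ≤ B * (((n : ℕ) + 1 : ℝ) * τ) ^ (-α)) :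
    scaledWeakLp τ (1 / α) x ≤ ENNReal.ofReal B := by
  refine iSup₂_le fun l hl => ?_
  have hl' : (0 : ℝ) < l := hl
  set y : ℝ := (B / l) ^ (1 / α) / τ with hy
  have hy0 : 0 ≤ y := by positivity
  set S : Set (Fin N) := {n : Fin N | (l : ℝ) < ‖x n‖} with hS
  have hcard : (S.ncard : ℝ) ≤ y := by
    refine le_trans ?_ (Nat.floor_le hy0)
    rw [Nat.cast_le, ← Set.ncard_image_of_injective S Fin.val_injective]
    calc _ ≤ ((Finset.range ⌊y⌋₊ : Finset ℕ) : Set ℕ).ncard := by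
          refine Set.ncard_le_ncard ?_ (Finset.finite_toSet _)
          rintro _ ⟨n, hn, rfl⟩
          rw [Finset.mem_coe, Finset.mem_range, ← Nat.succ_le_iff]
          refine Nat.le_floor ?_
          push_cast
          rw [hy, le_div_iff₀ hτ]
          have ht : (0 : ℝ) < ((n : ℕ) + 1 : ℝ) * τ := by positivity
          have h1 : (l : ℝ) ≤ B * (((n : ℕ) + 1 : ℝ) * τ) ^ (-α) := (le_of_lt hn).trans (hx n)
          rw [Real.rpow_neg ht.le, ← div_eq_mul_inv, le_div_iff₀ (by positivity)] at h1
          rw [one_div, Real.le_rpow_inv_iff_of_pos ht.le (by positivity) hα₀, le_div_iff₀ hl']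
          linarith
      _ = ⌊y⌋₊ := by rw [Set.ncard_coe_finset, Finset.card_range]
  have e : ((l : ℝ≥0∞)) = ENNReal.ofReal l := (ENNReal.ofReal_coe_nnreal).symm
  rw [one_div, inv_inv, e, ← ENNReal.ofReal_natCast, ENNReal.ofReal_rpow_of_nonneg (by positivity)
    hα₀.le, ENNReal.ofReal_rpow_of_nonneg hτ.le hα₀.le, ← ENNReal.ofReal_mul (by positivity),
    ← ENNReal.ofReal_mul (by positivity)]
  refine ENNReal.ofReal_le_ofReal ?_
  calc (l : ℝ) * (S.ncard : ℝ) ^ α * τ ^ α = l * (S.ncard * τ) ^ α := by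
        rw [Real.mul_rpow (by positivity) hτ.le, mul_assoc]
    _ ≤ l * ((B / l) ^ (1 / α)) ^ α := by
        gcongr
        calc (S.ncard : ℝ) * τ ≤ y * τ := by gcongr
          _ = _ := by rw [hy]; field_simp
    _ = B := by
        rw [← Real.rpow_mul (by positivity), one_div, inv_mul_cancel₀ hα₀.ne', Real.rpow_one]
        field_simp

/-- The induction step is Bernoulli's inequality for the concave power 1 - s at -1/(N + 1). -/
theorem sum_rpow_neg_le {s : ℝ} (hs₀ : 0 ≤ s) (hs₁ : s < 1) (N : ℕ) :
    ∑ n ∈ Finset.range N, (n + 1 : ℝ) ^ (-s) ≤ (N : ℝ) ^ (1 - s) / (1 - s) := by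
  have hq : 0 < 1 - s := by linarith
  induction N with
  | zero =>
    rw [Finset.sum_range_zero]
    positivity
  | succ N ih =>
    rw [Finset.sum_range_succ]
    refine (add_le_add_left ih _).trans ?_
    have hN : (0 : ℝ) < N + 1 := by positivity
    have hx : (-1 : ℝ) ≤ -(1 / (N + 1)) := by
      rw [neg_le_neg_iff, div_le_one hN]
      linarith [(Nat.cast_nonneg N : (0 : ℝ) ≤ N)]
    have hb := rpow_one_add_le_one_add_mul_self hx hq.le (by linarith)
    have h1 : (1 + -(1 / (N + 1)) : ℝ) = N / (N + 1) := by field_simp; ring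
    rw [h1, Real.div_rpow (by positivity) hN.le, div_le_iff₀ (by positivity)] at hb
    have h2 : (N + 1 : ℝ) ^ (1 - s) = (N + 1) * (N + 1 : ℝ) ^ (-s) := by
      rw [sub_eq_add_neg, Real.rpow_add hN, Real.rpow_one]
    push_cast
    rw [div_add' _ _ _ hq.ne']
    gcongr
    rw [h2] at hb ⊢
    have h3 : (1 + (1 - s) * -(1 / (N + 1)) : ℝ) * ((N + 1) * (N + 1 : ℝ) ^ (-s))
        = (N + 1) * (N + 1 : ℝ) ^ (-s) - (1 - s) * (N + 1 : ℝ) ^ (-s) := by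
      field_simp
      ring
    linarith

theorem scaledLp_le {α τ B : ℝ} (hα₀ : 0 < α) (hτ : 0 < τ) (hB : 0 ≤ B) {p : ℝ≥0∞} (hp : 1 ≤ p)
    (hpα : p < ENNReal.ofReal (1 / α)) {N : ℕ}
    {x : Fin N → X} (hx : ∀ n : Fin N, ‖x n‖ ≤ B * (((n : ℕ) + 1 : ℝ) * τ) ^ (-α)) :
    scaledLp τ p x ≤ ENNReal.ofReal ((1 / (1 - α * p.toReal)) ^ p.toReal⁻¹)
      * ENNReal.ofReal (N * τ) ^ (p⁻¹.toReal - α) * ENNReal.ofReal B := by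
  have hptop : p ≠ ∞ := (hpα.trans ENNReal.ofReal_lt_top).ne
  have hq1 : 1 ≤ p.toReal := by
    rw [← ENNReal.toReal_one]
    exact ENNReal.toReal_mono hptop hp
  have hqα : p.toReal < 1 / α := by
    rwa [ENNReal.lt_ofReal_iff_toReal_lt hptop] at hpα
  rw [scaledLp, if_neg hptop, ENNReal.toReal_inv]
  set q := p.toReal
  have hq0 : 0 < q := by linarith
  have hs : α * q < 1 := by rwa [lt_div_iff₀ hα₀, mul_comm] at hqα
  have hs' : 0 < 1 - α * q := by linarith
  have hexp : 0 ≤ q⁻¹ - α := by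
    rw [sub_nonneg, ← one_div, le_div_iff₀ hq0]
    exact hs.le
  have hsum : ENNReal.ofReal τ * ∑ n, ‖x n‖ₑ ^ q
      ≤ ENNReal.ofReal (1 / (1 - α * q) * (N * τ) ^ (1 - α * q) * B ^ q) := by
    have h1 : ∀ n : Fin N, ‖x n‖ₑ ^ q
        ≤ ENNReal.ofReal (B ^ q * τ ^ (-(α * q)) * ((n : ℕ) + 1 : ℝ) ^ (-(α * q))) := by
      intro n
      rw [← ofReal_norm, ENNReal.ofReal_rpow_of_nonneg (norm_nonneg _) hq0.le]
      refine ENNReal.ofReal_le_ofReal ?_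
      calc ‖x n‖ ^ q ≤ (B * (((n : ℕ) + 1 : ℝ) * τ) ^ (-α)) ^ q := by gcongr; exact hx n
        _ = _ := by
          rw [Real.mul_rpow hB (by positivity), ← Real.rpow_mul (by positivity),
            Real.mul_rpow (by positivity) hτ.le, neg_mul]
          ring
    calc _ ≤ ENNReal.ofReal τ * ∑ n : Fin N,
          ENNReal.ofReal (B ^ q * τ ^ (-(α * q)) * ((n : ℕ) + 1 : ℝ) ^ (-(α * q))) := by
          gcongr with n
          exact h1 n
      _ = ENNReal.ofReal (τ * (B ^ q * τ ^ (-(α * q))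
            * ∑ n ∈ Finset.range N, (n + 1 : ℝ) ^ (-(α * q)))) := by
          rw [← ENNReal.ofReal_sum_of_nonneg fun _ _ => by positivity,
            ← ENNReal.ofReal_mul hτ.le, ← Finset.mul_sum,
            Fin.sum_univ_eq_sum_range (fun n => (n + 1 : ℝ) ^ (-(α * q)))]
      _ ≤ _ := by
          refine ENNReal.ofReal_le_ofReal ?_
          calc _ ≤ τ * (B ^ q * τ ^ (-(α * q)) * ((N : ℝ) ^ (1 - α * q) / (1 - α * q))) := by
                gcongr
                exact sum_rpow_neg_le (by positivity) hs N
            _ = _ := by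
                rw [Real.mul_rpow (by positivity) hτ.le, sub_eq_add_neg 1 (α * q),
                  Real.rpow_add hτ, Real.rpow_one]
                ring
  calc _ ≤ (ENNReal.ofReal (1 / (1 - α * q) * (N * τ) ^ (1 - α * q) * B ^ q)) ^ q⁻¹ := by
        gcongr
    _ = ENNReal.ofReal ((1 / (1 - α * q)) ^ q⁻¹ * (N * τ) ^ (q⁻¹ - α) * B) := by
        rw [ENNReal.ofReal_rpow_of_nonneg (by positivity) (by positivity),
          Real.mul_rpow (by positivity) (by positivity),
          Real.mul_rpow (by positivity) (by positivity), Real.rpow_rpow_inv hB hq0.ne',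
          ← Real.rpow_mul (by positivity)]
        congr 4
        field_simp
    _ = _ := by
        rw [ENNReal.ofReal_mul (by positivity), ENNReal.ofReal_mul (by positivity),
          ENNReal.ofReal_rpow_of_nonneg (by positivity) hexp]

end Norms

/-! ### The K-functional and the interpolation norm -/

section KFunctional
variable {X : Type*} [NormedAddCommGroup X] [NormedSpace ℂ X]

theorem ofReal_inv_mul_kFunctional (A : X →ₗ.[ℂ] X) {t : ℝ} (ht : 0 < t) (v : X) :
    ENNReal.ofReal t⁻¹ * kFunctional A t v
      = ⨅ b : A.domain, ENNReal.ofReal t⁻¹ * ‖v - (b : X)‖ₑ + (‖(b : X)‖ₑ + ‖A b‖ₑ) := by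
  rw [kFunctional, ENNReal.mul_iInf_of_ne (by simpa using ht) ENNReal.ofReal_ne_top]
  refine iInf_congr fun b => ?_
  rw [mul_add, ← mul_assoc, ← ENNReal.ofReal_mul (by positivity), inv_mul_cancel₀ ht.ne',
    ENNReal.ofReal_one, one_mul]

/-- After division by t, only the coefficient of ‖v - b‖ depends on t, and it decreases. -/
theorem ofReal_inv_mul_kFunctional_anti (A : X →ₗ.[ℂ] X) {s t : ℝ} (hs : 0 < s) (hst : s ≤ t)
    (v : X) :
    ENNReal.ofReal t⁻¹ * kFunctional A t v ≤ ENNReal.ofReal s⁻¹ * kFunctional A s v := by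
  rw [ofReal_inv_mul_kFunctional A hs, ofReal_inv_mul_kFunctional A (hs.trans_le hst)]
  refine iInf_mono fun b => ?_
  gcongr

theorem enorm_le_kFunctional {A : X →ₗ.[ℂ] X} {t C : ℝ} (ht : 0 < t) (hC : 0 ≤ C) {v w : X}
    (h : ∀ b : A.domain, ‖w‖ ≤ C * (t⁻¹ * ‖v - b‖ + ‖A b‖)) :
    ‖w‖ₑ ≤ ENNReal.ofReal C * (ENNReal.ofReal t⁻¹ * kFunctional A t v) := by
  rw [ofReal_inv_mul_kFunctional A ht, ENNReal.mul_iInf (by simp)]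
  · refine le_iInf fun b => ?_
    calc ‖w‖ₑ ≤ ENNReal.ofReal (C * (t⁻¹ * ‖v - b‖ + ‖A b‖)) := by
          rw [← ofReal_norm]
          exact ENNReal.ofReal_le_ofReal (h b)
      _ = ENNReal.ofReal C * (ENNReal.ofReal t⁻¹ * ‖v - (b : X)‖ₑ + ‖A b‖ₑ) := by
          rw [ENNReal.ofReal_mul hC, ENNReal.ofReal_add (by positivity) (by positivity),
            ENNReal.ofReal_mul (by positivity), ofReal_norm, ofReal_norm]
      _ ≤ _ := by
          gcongr
          exact le_add_self

/-- For θ = 1 - 1/(qα) the integrand is (K(t,v)/t)^q with weight t^(1/α-1). This weight gives each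
interval from (nτ)^α to ((n+1)τ)^α mass ατ, so the sum is a lower Riemann sum of a decreasing
function. -/
theorem sum_kFunctional_le {A : X →ₗ.[ℂ] X} {α τ q : ℝ} (hα₀ : 0 < α) (hτ : 0 < τ) (hq : 0 < q)
    (v : X) (N : ℕ) :
    ENNReal.ofReal τ * ∑ n ∈ Finset.range N,
        (ENNReal.ofReal (((n + 1 : ℝ) * τ) ^ α)⁻¹ * kFunctional A (((n + 1 : ℝ) * τ) ^ α) v) ^ q
      ≤ ENNReal.ofReal α⁻¹ * ∫⁻ t in Set.Ioi (0 : ℝ),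
        (ENNReal.ofReal (t ^ (-(1 - q⁻¹ / α))) * kFunctional A t v) ^ q * ENNReal.ofReal t⁻¹ := by
  set φ : ℝ → ℝ≥0∞ := fun t => ENNReal.ofReal t⁻¹ * kFunctional A t v with hφ
  set F : ℝ → ℝ≥0∞ := fun t =>
    (ENNReal.ofReal (t ^ (-(1 - q⁻¹ / α))) * kFunctional A t v) ^ q * ENNReal.ofReal t⁻¹ with hF
  set σ : ℕ → ℝ := fun n => ((n : ℝ) * τ) ^ α with hσ
  have hσ0 : ∀ n, 0 ≤ σ n := fun n => by positivity
  have hmono : Monotone σ := fun m n hmn => by simp only [hσ]; gcongr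
  have hFt : ∀ t, 0 < t → F t = φ t ^ q * ENNReal.ofReal (t ^ (α⁻¹ - 1)) := by
    intro t ht
    have h1 : t ^ (-(1 - q⁻¹ / α)) = t⁻¹ * t ^ (q⁻¹ / α) := by
      rw [← Real.rpow_neg_one t, ← Real.rpow_add ht]
      congr 1
      ring
    have h2 : (ENNReal.ofReal (t ^ (q⁻¹ / α))) ^ q * ENNReal.ofReal t⁻¹
        = ENNReal.ofReal (t ^ (α⁻¹ - 1)) := by
      rw [ENNReal.ofReal_rpow_of_nonneg (by positivity) hq.le, ← Real.rpow_mul ht.le,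
        ← ENNReal.ofReal_mul (by positivity), ← Real.rpow_neg_one t, ← Real.rpow_add ht]
      congr 2
      field_simp
      ring
    simp only [hF, hφ]
    rw [h1, ENNReal.ofReal_mul (by positivity), mul_right_comm,
      ENNReal.mul_rpow_of_nonneg _ _ hq.le, mul_assoc, h2]
  have hpiece : ∀ n : ℕ, ENNReal.ofReal (α * τ) * φ (σ (n + 1)) ^ q
      ≤ ∫⁻ t in Set.Ioc (σ n) (σ (n + 1)), F t := by
    intro n
    have hint : ∫⁻ t in Set.Ioc (σ n) (σ (n + 1)), ENNReal.ofReal (t ^ (α⁻¹ - 1))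
        = ENNReal.ofReal (α * τ) := by
      have hgt : -1 < α⁻¹ - 1 := by
        have : 0 < α⁻¹ := by positivity
        linarith
      have hii : IntervalIntegrable (fun t : ℝ => t ^ (α⁻¹ - 1)) MeasureTheory.volume
          (σ n) (σ (n + 1)) := intervalIntegral.intervalIntegrable_rpow' hgt
      rw [← MeasureTheory.ofReal_integral_eq_lintegral_ofReal
        ((intervalIntegrable_iff_integrableOn_Ioc_of_le (hmono n.le_succ)).mp hii),
        ← intervalIntegral.integral_of_le (hmono n.le_succ), integral_rpow (Or.inl hgt),
        sub_add_cancel]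
      · congr 1
        simp only [hσ]
        rw [Real.rpow_rpow_inv (by positivity) hα₀.ne', Real.rpow_rpow_inv (by positivity) hα₀.ne']
        push_cast
        field_simp
        ring
      · filter_upwards [MeasureTheory.self_mem_ae_restrict measurableSet_Ioc] with t ht
        exact Real.rpow_nonneg ((hσ0 n).trans ht.1.le) _
    rw [← hint, mul_comm, ← MeasureTheory.lintegral_const_mul _ (by fun_prop)]
    refine MeasureTheory.setLIntegral_mono' measurableSet_Ioc fun t ht => ?_
    have ht0 : 0 < t := (hσ0 n).trans_lt ht.1
    rw [hFt t ht0]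
    gcongr
    exact ofReal_inv_mul_kFunctional_anti A ht0 ht.2 v
  have hsum : ∑ n ∈ Finset.range N, ENNReal.ofReal (α * τ) * φ (σ (n + 1)) ^ q
      ≤ ∫⁻ t in Set.Ioi (0 : ℝ), F t := by
    refine (Finset.sum_le_sum fun n _ => hpiece n).trans ?_
    rw [← MeasureTheory.lintegral_biUnion_finset (t := fun n => Set.Ioc (σ n) (σ (n + 1)))
      (fun i _ j _ hij => hmono.pairwise_disjoint_on_Ioc_succ hij) fun _ _ => measurableSet_Ioc]
    refine MeasureTheory.lintegral_mono_set (Set.iUnion₂_subset fun n _ t ht => ?_)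
    exact (hσ0 n).trans_lt ht.1
  have hα : ENNReal.ofReal τ = ENNReal.ofReal α⁻¹ * ENNReal.ofReal (α * τ) := by
    rw [← ENNReal.ofReal_mul (by positivity), inv_mul_cancel_left₀ hα₀.ne']
  rw [hα, mul_assoc, Finset.mul_sum]
  gcongr
  refine le_trans (le_of_eq ?_) hsum
  simp only [hφ, hσ]
  push_cast
  rfl

theorem scaledLp_le_interpNorm {A : X →ₗ.[ℂ] X} {α τ C : ℝ} (hα₀ : 0 < α) (hα₁ : α < 1)
    (hτ : 0 < τ) (hC : 0 ≤ C) {p : ℝ≥0∞} (hp : 1 ≤ p) {v : X} {N : ℕ} {x : Fin N → X}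
    (hx : ∀ (n : Fin N) (b : A.domain),
      ‖x n‖ ≤ C * ((((n : ℕ) + 1 : ℝ) * τ) ^ (-α) * ‖v - b‖ + ‖A b‖)) :
    scaledLp τ p x ≤ ENNReal.ofReal (C / α) * interpNorm A (1 - p⁻¹.toReal / α) p v := by
  have hCα : C ≤ C / α := by rw [le_div_iff₀ hα₀]; nlinarith
  have hx' : ∀ n : Fin N, ‖x n‖ₑ ≤ ENNReal.ofReal C *
      (ENNReal.ofReal ((((n : ℕ) + 1 : ℝ) * τ) ^ α)⁻¹
        * kFunctional A ((((n : ℕ) + 1 : ℝ) * τ) ^ α) v) := by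
    intro n
    refine enorm_le_kFunctional (by positivity) hC fun b => ?_
    rw [← Real.rpow_neg (by positivity)]
    exact hx n b
  by_cases hptop : p = ∞
  · rw [scaledLp, interpNorm, if_pos hptop, if_pos hptop, hptop]
    refine iSup_le fun n => (hx' n).trans ?_
    gcongr
    -- At p = ∞ the exponent θ is 1, so K(t,v)/t is one of the values in the supremum.
    refine le_trans (le_of_eq ?_) (le_iSup₂ (((((n : ℕ) + 1 : ℝ) * τ) ^ α)) (by positivity))
    simp [Real.rpow_neg_one]
  · have hq1 : 1 ≤ p.toReal := by
      rw [← ENNReal.toReal_one]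
      exact ENNReal.toReal_mono hptop hp
    rw [scaledLp, interpNorm, if_neg hptop, if_neg hptop, ENNReal.toReal_inv]
    set q := p.toReal
    have hq0 : 0 < q := by linarith
    have hsum := sum_kFunctional_le (A := A) hα₀ hτ hq0 v N
    rw [← Fin.sum_univ_eq_sum_range (fun n => (ENNReal.ofReal (((n + 1 : ℝ) * τ) ^ α)⁻¹
      * kFunctional A (((n + 1 : ℝ) * τ) ^ α) v) ^ q)] at hsum
    set I := ∫⁻ t in Set.Ioi (0 : ℝ),
      (ENNReal.ofReal (t ^ (-(1 - q⁻¹ / α))) * kFunctional A t v) ^ q * ENNReal.ofReal t⁻¹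
    have h1 : ENNReal.ofReal τ * ∑ n, ‖x n‖ₑ ^ q
        ≤ ENNReal.ofReal C ^ q * (ENNReal.ofReal α⁻¹ * I) := by
      refine le_trans ?_ (mul_le_mul_right hsum _)
      rw [mul_left_comm]
      gcongr
      rw [Finset.mul_sum]
      refine Finset.sum_le_sum fun n _ => ?_
      rw [← ENNReal.mul_rpow_of_nonneg _ _ hq0.le]
      gcongr
      exact hx' n
    calc _ ≤ (ENNReal.ofReal C ^ q * (ENNReal.ofReal α⁻¹ * I)) ^ q⁻¹ := by gcongr
      _ = ENNReal.ofReal C * (ENNReal.ofReal α⁻¹ ^ q⁻¹ * I ^ q⁻¹) := by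
          rw [ENNReal.mul_rpow_of_nonneg _ _ (by positivity),
            ENNReal.mul_rpow_of_nonneg _ _ (by positivity), ENNReal.rpow_rpow_inv hq0.ne']
      _ ≤ ENNReal.ofReal C * (ENNReal.ofReal α⁻¹ * I ^ q⁻¹) := by
          gcongr
          have : 1 ≤ ENNReal.ofReal α⁻¹ := by
            rw [ENNReal.one_le_ofReal]
            exact (one_le_inv₀ hα₀).mpr hα₁.le
          calc _ ≤ ENNReal.ofReal α⁻¹ ^ (1 : ℝ) :=
                ENNReal.rpow_le_rpow_of_exponent_le this (inv_le_one_of_one_le₀ hq1)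
            _ = _ := ENNReal.rpow_one _
      _ = _ := by rw [← mul_assoc, ← ENNReal.ofReal_mul hC, div_eq_mul_inv]

end KFunctional

/-! ### Decay for general v and conclusion -/

theorem pointwiseConst_nonneg {α : ℝ} (hα₁ : α < 1) (M : ℝ) : 0 ≤ pointwiseConst α M := by
  have hc1 : 0 ≤ coeffConst (2 - α) := div_nonneg (by positivity) (by linarith)
  have hc2 : 0 ≤ coeffConst 2 := div_nonneg (by positivity) (by norm_num)
  unfold pointwiseConst
  positivity

section Decay
variable {X : Type*} [NormedAddCommGroup X] [NormedSpace ℂ X] [CompleteSpace X]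
  {A : X →ₗ.[ℂ] X} {α τ M : ℝ} {v : X} {u : ℕ → X}

theorem norm_beDeriv_sub_le_rpow (hα₀ : 0 < α) (hα₁ : α < 1) (hτ : 0 < τ)
    (hA : IsSectorial A (α * Real.pi / 2)) (hM : SectorialBound A (α * Real.pi / 2) M)
    (hu : IsBESolution A α τ v u) (n : ℕ) :
    ‖beDeriv α τ (fun j => u j - v) (n + 1)‖
      ≤ pointwiseConst α M * ‖v‖ * ((n + 1) * τ) ^ (-α) := by
  -- The choice b = 0 needs no regularity of v.
  have h := norm_beDeriv_sub_le hα₀ hα₁ hτ hA hM hu n 0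
  rw [LinearPMap.map_zero, norm_zero, add_zero, ZeroMemClass.coe_zero, sub_zero] at h
  linarith

theorem norm_beDeriv_le_rpow (hα₀ : 0 < α) (hα₁ : α < 1) (hτ : 0 < τ)
    (hA : IsSectorial A (α * Real.pi / 2)) (hM : SectorialBound A (α * Real.pi / 2) M)
    (hu : IsBESolution A α τ v u) (n : ℕ) :
    ‖beDeriv α τ u (n + 1)‖ ≤ (pointwiseConst α M + 1) * ‖v‖ * ((n + 1) * τ) ^ (-α) := by
  have h1 := norm_beDeriv_sub_le_rpow hα₀ hα₁ hτ hA hM hu n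
  have h2 := norm_beDeriv_le hα₀ hα₁ hτ u v n
  linarith

end Decay

end FracBE

open FracBE in
theorem theorem7p1 (α : ℝ) (hα₀ : 0 < α) (hα₁ : α < 1) (M : ℝ) (p : ℝ≥0∞) (hp : 1 ≤ p) :
    ∃ c : ℝ≥0, ∀ (X : Type*) [NormedAddCommGroup X] [NormedSpace ℂ X] [CompleteSpace X]
      (A : X →ₗ.[ℂ] X), IsSectorial A (α * Real.pi / 2) → SectorialBound A (α * Real.pi / 2) M →
      ∀ (τ : ℝ), 0 < τ → ∀ (v : X) (u : ℕ → X) (hu : IsBESolution A α τ v u) (N : ℕ),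
        (ENNReal.ofReal (1 / α) < p →
          scaledLp τ p (fun n : Fin N => beDeriv α τ (fun j => u j - v) (n + 1)) +
              scaledLp τ p (fun n : Fin N => A ⟨u (n + 1), hu.mem n⟩)
            ≤ c * interpNorm A (1 - p⁻¹.toReal / α) p v) ∧
        (p = ENNReal.ofReal (1 / α) →
          scaledWeakLp τ (1 / α) (fun n : Fin N => beDeriv α τ (fun j => u j - v) (n + 1)) +
              scaledWeakLp τ (1 / α) (fun n : Fin N => beDeriv α τ u (n + 1)) +
              scaledWeakLp τ (1 / α) (fun n : Fin N => A ⟨u (n + 1), hu.mem n⟩)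
            ≤ c * ‖v‖ₑ) ∧
        (p < ENNReal.ofReal (1 / α) →
          scaledLp τ p (fun n : Fin N => beDeriv α τ (fun j => u j - v) (n + 1)) +
              scaledLp τ p (fun n : Fin N => beDeriv α τ u (n + 1)) +
              scaledLp τ p (fun n : Fin N => A ⟨u (n + 1), hu.mem n⟩)
            ≤ c * ENNReal.ofReal (N * τ) ^ (p⁻¹.toReal - α) * ‖v‖ₑ) := by
  set C := pointwiseConst α M with hCdef
  have hC : 0 ≤ C := pointwiseConst_nonneg hα₁ M
  have hsplit : ∀ r : ℝ, 0 ≤ r → ENNReal.ofReal (C * r) + ENNReal.ofReal ((C + 1) * r)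
      + ENNReal.ofReal (C * r) = ENNReal.ofReal (3 * C + 1) * ENNReal.ofReal r := by
    intro r hr
    rw [← ENNReal.ofReal_add (by positivity) (by positivity),
      ← ENNReal.ofReal_add (by positivity) (by positivity), ← ENNReal.ofReal_mul (by positivity)]
    congr 1
    ring
  -- Since p is fixed before c, only one of the three claims is live and c is chosen for it alone.
  rcases lt_trichotomy p (ENNReal.ofReal (1 / α)) with hlt | heq | hgt
  · refine ⟨Real.toNNReal ((1 / (1 - α * p.toReal)) ^ p.toReal⁻¹) * Real.toNNReal (3 * C + 1),
      fun X _ _ _ A hA hM τ hτ v u hu N =>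
        ⟨fun h => absurd h hlt.asymm, fun h => absurd h hlt.ne, fun _ => ?_⟩⟩
    simp only [← hu.eq]
    have hd := scaledLp_le (N := N) hα₀ hτ (by positivity : 0 ≤ C * ‖v‖) hp hlt
      fun n => norm_beDeriv_sub_le_rpow hα₀ hα₁ hτ hA hM hu n
    have he := scaledLp_le (N := N) hα₀ hτ (by positivity : 0 ≤ (C + 1) * ‖v‖) hp hlt
      fun n => norm_beDeriv_le_rpow hα₀ hα₁ hτ hA hM hu n
    refine (add_le_add (add_le_add hd he) hd).trans (le_of_eq ?_)
    rw [← mul_add, ← mul_add, hsplit _ (norm_nonneg v), ofReal_norm, ENNReal.coe_mul]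
    simp only [ENNReal.ofReal]
    ring
  · refine ⟨Real.toNNReal (3 * C + 1), fun X _ _ _ A hA hM τ hτ v u hu N =>
      ⟨fun h => absurd heq h.ne', fun _ => ?_, fun h => absurd heq h.ne⟩⟩
    simp only [← hu.eq]
    have hd := scaledWeakLp_le (N := N) hα₀ hτ (by positivity : 0 ≤ C * ‖v‖)
      fun n => norm_beDeriv_sub_le_rpow hα₀ hα₁ hτ hA hM hu n
    have he := scaledWeakLp_le (N := N) hα₀ hτ (by positivity : 0 ≤ (C + 1) * ‖v‖)
      fun n => norm_beDeriv_le_rpow hα₀ hα₁ hτ hA hM hu n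
    refine (add_le_add (add_le_add hd he) hd).trans (le_of_eq ?_)
    rw [hsplit _ (norm_nonneg v), ofReal_norm]
    rfl
  · refine ⟨2 * Real.toNNReal (C / α), fun X _ _ _ A hA hM τ hτ v u hu N =>
      ⟨fun _ => ?_, fun h => absurd h hgt.ne', fun h => absurd h hgt.asymm⟩⟩
    simp only [← hu.eq]
    have hd := scaledLp_le_interpNorm (N := N) hα₀ hα₁ hτ hC hp
      fun n b => norm_beDeriv_sub_le hα₀ hα₁ hτ hA hM hu n b
    refine (add_le_add hd hd).trans (le_of_eq ?_)
    rw [← two_mul, ENNReal.coe_mul, mul_assoc]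
    rfl
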